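/- Let $K$ be a field. An ($\mathbb R$-)filtration on a finite-dimensional $K$-vector space $W$ is a family $(\mathcal F_tW)_{t\in\mathbb R}$ of subspaces of $W$ such that $\mathcal F_sW\subset\mathcal F_tW$ for $t\le s$, $\mathcal F_tW=0$ for all sufficiently large $t$, $\mathcal F_tW=W$ for all sufficiently negative $t$, and $t\mapsto\operatorname{rk}(\mathcal F_tW)$ is left continuous. Put $\lambda(x)=\sup\{a\in\mathbb R : x\in\mathcal F_aW\}\in\mathbb R\cup\{+\infty\}$ for $x\in W$ (so $\lambda(0)=+\infty$), and $\lambda_{\max}(W)=\max_{x\in W\setminus\{0\}}\lambda(x)$, with $\lambda_{\max}(0)=-\infty$. If $W\ne0$, let $\nu_W$ be the Borel probability measure on $\mathbb R$ that is the distributional derivative of $t\mapsto-\operatorname{rk}(\mathcal F_tW)/\operatorname{rk}(W)$; let $\nu_0=0$. Let $B=\bigoplus_{n\ge0}B_n$ be a commutative graded $K$-algebra that is an integral domain. Assume that $B$ is approximable, i.e. (a) every $B_n$ is finite-dimensional over $K$, and $B_n\neq0$ for all sufficiently large $n$; (b) for every $\varepsilon\in(0,1)$ there is an integer $p_0\ge1$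 such that for every integer $p\ge p_0$, $$\liminf_{n\to\infty}\frac{\operatorname{rk}\big(\operatorname{Im}(S^nB_p\to B_{np})\big)}{\operatorname{rk}(B_{np})}>1-\varepsilon,$$ where $S^nB_p\to B_{np}$ is the canonical homomorphism given by multiplication in $B$. Let $f:\mathbb N\to\mathbb R_{\ge 0}$ be a function, and let every $B_n$ be equipped with an $\mathbb R$-filtration such that $B$ is $f$-quasi-filtered: there is $n_0\in\mathbb N$ such that for every integer $l\ge2$ and all homogeneous elements $x_1,\dots,x_l$ of $B$ of degrees $n_1,\dots,n_l\ge n_0$, $$\lambda(x_1\cdots x_l)\ \ge\ \sum_{i=1}^l\big(\lambda(x_i)-f(n_i)\big).$$ Assume moreover that $$\sup_{n\ge1}\lambda_{\max}(B_n)/n<+\infty\qquad\text{and}\qquad\lim_{n\to\infty}f(n)/n=0 .$$ Then the sequence $(\lambda_{\max}(B_n)/n)_{n\ge1}$ converges to a real number. Moreover, writing $T_{1/n}\nu_{B_n}$ for the direct image of $\nu_{B_n}$ under $x\mapsto x/n$, the sequence of measures $(T_{1/n}\nu_{B_n})_{n\ge1}$ converges vaguely to a Borel probability measure $\nu$ on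 $\mathbb R$; that is, $\int h\,\mathrm d(T_{1/n}\nu_{B_n})\to\int h\,\mathrm d\nu$ for every continuous function $h:\mathbb R\to\mathbb R$ with compact support. -/

import Mathlib

open Filter Topology MeasureTheory

noncomputable section

/-- A (decreasing, left-continuous, separated and exhaustive) `ℝ`-filtration of a `K`-vector space
`W` (used for `W` of finite rank). -/
structure RFiltration (K : Type*) [Field K] (W : Type*) [AddCommGroup W] [Module K W] where
  /-- The subspaces of the filtration. -/
  F : ℝ → Submodule K W
  antitone : Antitone F
  eventually_bot : ∀ᶠ t in atTop, F t = ⊥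
  eventually_top : ∀ᶠ t in atBot, F t = ⊤
  left_continuous : ∀ t : ℝ,
    ContinuousWithinAt (fun s : ℝ => (Module.finrank K (F s) : ℝ)) (Set.Iic t) t

namespace RFiltration

variable {K : Type*} [Field K] {W : Type*} [AddCommGroup W] [Module K W]

/-- `λ(x) = sup {a ∈ ℝ | x ∈ F_a W}`, with `λ(0) = +∞`. -/
def lam (𝓕 : RFiltration K W) (x : W) : EReal :=
  sSup ((fun a : ℝ => (a : EReal)) '' {a : ℝ | x ∈ 𝓕.F a})

/-- `λ_max(W) = max_{x ∈ W ∖ {0}} λ(x)`, with `λ_max(0) = -∞`. -/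
def lamMax (𝓕 : RFiltration K W) : EReal :=
  ⨆ x : {x : W // x ≠ 0}, 𝓕.lam x

/-- The increasing function `t ↦ - rk (F_t W) / rk W` (it is zero if `W = 0`). -/
def negRank (𝓕 : RFiltration K W) (t : ℝ) : ℝ :=
  -((Module.finrank K (𝓕.F t) : ℝ) / (Module.finrank K W : ℝ))

theorem negRank_mono (𝓕 : RFiltration K W) (hW : FiniteDimensional K W) :
    Monotone 𝓕.negRank := by
  intro s t hst
  have h : Module.finrank K (𝓕.F t) ≤ Module.finrank K (𝓕.F s) :=
    Submodule.finrank_mono (𝓕.antitone hst)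
  unfold negRank
  gcongr

/-- The Borel measure `ν_W` on `ℝ`: the distributional derivative of the increasing function
`t ↦ - rk (F_t W) / rk W`, i.e. its Lebesgue-Stieltjes measure
(`Monotone.stieltjesFunction` replaces the function by its right limits, which changes it only at
countably many points and so does not change the derivative). It is the zero measure if `W = 0`. -/
def nu (𝓕 : RFiltration K W) (hW : FiniteDimensional K W) : Measure ℝ :=
  (𝓕.negRank_mono hW).stieltjesFunction.measure

end RFiltration

/-- An integral graded `K`-algebra `B = ⨁ B_n` is approximable. The `K`-subspace `(ℬ p) ^ n` of `B`
is spanned by the products of `n` elements of `B_p`: it is the image of `S^n B_p → B_{np}`. -/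
structure IsApproximable {K : Type*} [Field K] {B : Type*} [CommRing B] [IsDomain B] [Algebra K B]
    (ℬ : ℕ → Submodule K B) [GradedAlgebra ℬ] : Prop where
  finiteDimensional : ∀ n : ℕ, FiniteDimensional K (ℬ n)
  eventually_ne_bot : ∀ᶠ n : ℕ in atTop, ℬ n ≠ ⊥
  approx : ∀ ε : ℝ, 0 < ε → ε < 1 → ∃ p₀ : ℕ, 1 ≤ p₀ ∧ ∀ p : ℕ, p₀ ≤ p →
    1 - ε < liminf (fun n : ℕ =>
      (Module.finrank K ((ℬ p) ^ n : Submodule K B) : ℝ) / (Module.finrank K (ℬ (n * p)) : ℝ)) atTop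

/-- The graded algebra `B = ⨁ B_n`, each `B_n` carrying an `ℝ`-filtration, is `f`-quasi-filtered:
there is `n₀` such that `λ(x_1 ⋯ x_l) ≥ ∑ (λ(x_i) - f(n_i))` for all `l ≥ 2` and all homogeneous
`x_i` of degrees `n_i ≥ n₀`. -/
def IsQuasiFiltered {K : Type*} [Field K] {B : Type*} [CommRing B] [Algebra K B]
    (ℬ : ℕ → Submodule K B) [GradedAlgebra ℬ] (𝓕 : ∀ n : ℕ, RFiltration K (ℬ n))
    (f : ℕ → NNReal) : Prop :=
  ∃ n₀ : ℕ, ∀ l : ℕ, 2 ≤ l → ∀ d : Fin l → ℕ, (∀ i, n₀ ≤ d i) → ∀ x : ∀ i, ℬ (d i),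
    ∑ i, ((𝓕 (d i)).lam (x i) - (((f (d i) : NNReal) : ℝ) : EReal)) ≤
      (𝓕 (∑ i, d i)).lam
        ⟨∏ i, (x i : B), SetLike.prod_mem_graded ℬ d (fun i => (x i : B)) (fun i _ => (x i).2)⟩

/-- `T_ε ν`: the direct image of `ν` by `x ↦ ε x`. -/
def dilate (ε : ℝ) (ν : Measure ℝ) : Measure ℝ := ν.map (fun x : ℝ => ε * x)

/-- Vague convergence of a sequence of Borel measures on `ℝ`. -/
def VagueTendsto (ν : ℕ → Measure ℝ) (ν' : Measure ℝ) : Prop :=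
  ∀ h : ℝ → ℝ, Continuous h → HasCompactSupport h →
    Tendsto (fun n => ∫ x, h x ∂(ν n)) atTop (𝓝 (∫ x, h x ∂ν'))

end

/-!
The heart of the proof is a comparison of a single graded piece with all later ones
(`exists_eventually_le_finrank`): for a suitable `d`, with `rk B_n ≤ C n ^ d`, and for every
`W = F_a B_q` with `q` large,
`rk F_{ns} B_n ≥ η (n / (q + M)) ^ d rk W` for all large `n`, as soon as `η < 1` and
`s (q + M) < a - f(q) - c`, where the constants `M` and `c` do not depend on `q` and `a`. Elements
of `F_{ns} B_n` are obtained as products `w ^ k * u` with `w ∈ W`, where `u` is a product of about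
`d k` elements of a fixed piece `B_m`; the quasi-filtration bounds their level. What has to be seen
is that they span a space of dimension at least `k ^ d dim W`.

This is done with a valuation. Let `E` be the field of homogeneous fractions of degree zero.
Approximability implies that `E` is generated by the fractions `a / e` with `a ∈ B_p`, for a
suitable `p` and a fixed `e ∈ B_p` (`IsApproximable.degZeroField_le`): otherwise a missing fraction
would make the rank of the image of `S^n B_p` grow exponentially in `n`, while it is bounded by a
polynomial. Hence `E` is finitely generated, say of transcendence degree `d`, and Noether
normalization shows that `rk B_n ≤ C n ^ d` for the same `d`. On `E` there is a valuation, trivial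
on `K`, with value group isomorphic to `ℤ ^ d` and with a residue field of some finite degree `r`
over `K`; it extends the lexicographic monomial valuation of a rational function field, which is
pulled back from a field of Hahn series (`exists_monomialFrame`). A space `W` takes at least
`dim W / r` values. The `k`-th powers of elements with these values, times monomials with exponents
in `[0, k) ^ d`, which represent `ℤ ^ d` modulo `k`, have distinct values; times a basis of the
residue field they remain independent, and number at least `k ^ d dim W`
(`MonomialFrame.exists_pow_mul_finrank_le`).

Applied with `F_a B_q = B_q`, the comparison shows that `rk B_n / n ^ d` converges to a positive
real number. Dividing by it, the proportion of `F_{qt} B_q` in `B_q` is at most that of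
`F_{ns} B_n` in `B_n`, up to a small error, for `s < t` and `n ≫ q ≫ 0`, because `f(q) / q → 0`. So
the tails of the measures converge at the continuity points of their limit, and no mass is lost
(`exists_vagueTendsto`). For the convergence of `λ_max(B_n) / n` it is enough that `F_{qt} B_q ≠ 0`
implies `F_{ns} B_n ≠ 0` for all large `n`.
-/

noncomputable section

/-! ### Hahn series -/

section HahnSeries

variable {Γ K : Type*} [AddCommGroup Γ] [LinearOrder Γ] [IsOrderedAddMonoid Γ] [Field K]

/-- The valuation ring of the field of Hahn series: the series supported in nonnegative degrees. -/
def hahnInteger (Γ K : Type*) [AddCommGroup Γ] [LinearOrder Γ] [IsOrderedAddMonoid Γ] [Field K] :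
    ValuationSubring (HahnSeries Γ K) where
  carrier := {z | 0 ≤ z.orderTop}
  mul_mem' := by
    intro a b ha hb
    have h := (HahnSeries.addVal Γ K).map_mul a b
    simp only [HahnSeries.addVal_apply] at h
    simp only [Set.mem_ofPred_eq] at *
    rw [h]
    exact add_nonneg ha hb
  one_mem' := by simp
  add_mem' := by
    intro a b ha hb
    exact le_trans (le_min ha hb) ((HahnSeries.addVal Γ K).map_add a b)
  zero_mem' := by simp
  neg_mem' := by
    intro a ha
    simpa using ha
  mem_or_inv_mem' := by
    intro a
    by_cases h0 : a = 0
    · left; simp [h0]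
    have h := (HahnSeries.addVal Γ K).map_mul a a⁻¹
    rw [mul_inv_cancel₀ h0, (HahnSeries.addVal Γ K).map_one, HahnSeries.addVal_apply_of_ne h0,
      HahnSeries.addVal_apply_of_ne (inv_ne_zero h0)] at h
    have h' : (0 : Γ) = a.order + a⁻¹.order := by symm; exact_mod_cast h.symm
    have e1 := HahnSeries.addVal_apply_of_ne (Γ := Γ) h0
    have e2 := HahnSeries.addVal_apply_of_ne (Γ := Γ) (inv_ne_zero h0)
    rw [HahnSeries.addVal_apply] at e1 e2
    change 0 ≤ a.orderTop ∨ 0 ≤ a⁻¹.orderTop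
    rw [e1, e2]
    rcases le_total 0 a.order with h1 | h1
    · left; exact_mod_cast h1
    · right
      have : 0 ≤ a⁻¹.order := by
        by_contra hc
        push Not at hc
        have := add_neg_of_nonpos_of_neg h1 hc
        rw [← h'] at this
        exact lt_irrefl _ this
      exact_mod_cast this

theorem mem_hahnInteger {z : HahnSeries Γ K} : z ∈ hahnInteger Γ K ↔ 0 ≤ z.orderTop := Iff.rfl

theorem single_mem_hahnInteger {g : Γ} :
    (HahnSeries.single g (1 : K)) ∈ hahnInteger Γ K ↔ 0 ≤ g := by
  rw [mem_hahnInteger, HahnSeries.orderTop_single one_ne_zero]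
  exact_mod_cast Iff.rfl

/-- A series of positive order is in the maximal ideal: its inverse has negative order. -/
theorem hahnInteger_valuation_lt_one {z : HahnSeries Γ K} (h : 0 < z.orderTop) :
    (hahnInteger Γ K).valuation z < 1 := by
  by_cases h0 : z = 0
  · simp [h0]
  rw [← not_le]
  intro hc
  have h2 : (hahnInteger Γ K).valuation z⁻¹ ≤ 1 := by
    rw [map_inv₀]
    exact inv_le_one_of_one_le₀ hc
  rw [ValuationSubring.valuation_le_one_iff, mem_hahnInteger] at h2
  have h3 := (HahnSeries.addVal Γ K).map_mul z z⁻¹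
  rw [mul_inv_cancel₀ h0, (HahnSeries.addVal Γ K).map_one] at h3
  simp only [HahnSeries.addVal_apply] at h3
  have := add_pos_of_pos_of_nonneg h h2
  rw [← h3] at this
  exact lt_irrefl _ this

/-- The residue field of the ring of Hahn series with nonnegative support is the field of
coefficients. -/
theorem exists_valuation_sub_C_lt_one {z : HahnSeries Γ K} (h : z ∈ hahnInteger Γ K) :
    ∃ c : K, (hahnInteger Γ K).valuation (z - HahnSeries.C c) < 1 := by
  refine ⟨z.coeff 0, hahnInteger_valuation_lt_one ?_⟩
  have h1 : 0 ≤ (z - HahnSeries.C (z.coeff 0)).orderTop := by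
    have : HahnSeries.C (z.coeff 0) ∈ hahnInteger Γ K := by
      rw [mem_hahnInteger, HahnSeries.C_apply]
      exact HahnSeries.orderTop_single_le
    exact sub_mem h this
  refine lt_of_le_of_ne h1 fun hc => ?_
  have := HahnSeries.coeff_orderTop_ne hc.symm
  apply this
  simp

/-- Every nonzero Hahn series has the same valuation as a monomial. -/
theorem exists_valuation_eq_single {z : HahnSeries Γ K} (h : z ≠ 0) :
    ∃ g : Γ, (hahnInteger Γ K).valuation (z * HahnSeries.single g 1) = 1 := by
  refine ⟨-z.order, ?_⟩
  have hs : (HahnSeries.single (-z.order) (1 : K)) ≠ 0 := by simp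
  have ho : (z * HahnSeries.single (-z.order) 1).orderTop = 0 := by
    have h3 := (HahnSeries.addVal Γ K).map_mul z (HahnSeries.single (-z.order) 1)
    rw [HahnSeries.addVal_apply, HahnSeries.addVal_apply_of_ne h,
      HahnSeries.addVal_apply_of_ne hs, HahnSeries.order_single one_ne_zero] at h3
    rw [h3]
    norm_cast
    simp
  have hm : z * HahnSeries.single (-z.order) 1 ∈ hahnInteger Γ K := by
    rw [mem_hahnInteger, ho]
  refine le_antisymm (((hahnInteger Γ K).valuation_le_one_iff _).2 hm) ?_
  obtain ⟨c, hc⟩ := exists_valuation_sub_C_lt_one hm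
  by_contra hlt
  push Not at hlt
  set w := z * HahnSeries.single (-z.order) 1 with hw
  have hw0 : w ≠ 0 := mul_ne_zero h hs
  have hi : 0 ≤ (w⁻¹).orderTop := by
    have h3 := (HahnSeries.addVal Γ K).map_mul w w⁻¹
    rw [mul_inv_cancel₀ hw0, (HahnSeries.addVal Γ K).map_one] at h3
    simp only [HahnSeries.addVal_apply] at h3
    rw [ho, zero_add] at h3
    exact h3.le
  have h5 : (hahnInteger Γ K).valuation w⁻¹ ≤ 1 :=
    ((hahnInteger Γ K).valuation_le_one_iff _).2 hi
  rw [map_inv₀] at h5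
  have h6 : 0 < (hahnInteger Γ K).valuation w := by
    rw [zero_lt_iff]
    exact (Valuation.ne_zero_iff _).2 hw0
  exact absurd (one_lt_inv₀ h6 |>.2 hlt) (not_lt.2 h5)

theorem single_one_zpow (g : Γ) (n : ℤ) :
    (HahnSeries.single g (1 : K)) ^ n = HahnSeries.single (n • g) 1 := by
  cases n with
  | ofNat n => simp [HahnSeries.single_pow]
  | negSucc n =>
    rw [zpow_negSucc, HahnSeries.single_pow, HahnSeries.inv_single, negSucc_zsmul]
    simp

/-- If the exponents `m ↦ ∑ mᵢ eᵢ` are distinct, substituting the Hahn monomials of exponents `eᵢ`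
for the variables sends distinct monomials to distinct monomials, hence is injective. -/
theorem aeval_single_injective {σ : Type*} [Finite σ] (e : σ → Γ)
    (he : Function.Injective fun m : σ →₀ ℕ => m.sum fun i k => k • e i) :
    Function.Injective
      (MvPolynomial.aeval (R := K) fun i => (HahnSeries.single (e i) (1 : K))) := by
  have key : ∀ (p : MvPolynomial σ K),
      MvPolynomial.aeval (R := K) (fun i => (HahnSeries.single (e i) (1 : K))) p =
        ∑ m ∈ p.support, HahnSeries.single (m.sum fun i k => k • e i) (p.coeff m) := by
    intro p
    conv_lhs => rw [p.as_sum]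
    rw [map_sum]
    refine Finset.sum_congr rfl fun m hm => ?_
    clear hm
    rw [MvPolynomial.aeval_monomial]
    have hprod : (m.prod fun i k => (HahnSeries.single (e i) (1 : K)) ^ k) =
        HahnSeries.single (m.sum fun i k => k • e i) 1 := by
      simp only [HahnSeries.single_pow, one_pow]
      rw [Finsupp.prod, Finsupp.sum]
      induction m.support using Finset.cons_induction with
      | empty => simp
      | cons a s ha ih =>
        rw [Finset.prod_cons, Finset.sum_cons, ih, HahnSeries.single_mul_single, one_mul]
    rw [hprod, HahnSeries.algebraMap_apply, HahnSeries.C_apply, HahnSeries.single_mul_single]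
    simp
  rw [injective_iff_map_eq_zero]
  intro p hp
  rw [key] at hp
  ext m
  have := congrArg (fun z => HahnSeries.coeff z (m.sum fun i k => k • e i)) hp
  simp only [HahnSeries.coeff_sum, HahnSeries.coeff_zero] at this
  rw [Finset.sum_eq_single m] at this
  · simpa using this
  · intro b _ hb
    rw [HahnSeries.coeff_single_of_ne]
    exact fun h => hb (he h.symm)
  · intro h
    simp [MvPolynomial.notMem_support_iff.1 h]

end HahnSeries

/-! ### Valuations with free value group and finite residue field -/

section Valuations

/-- A sum of terms of distinct values has the value of one of its terms. -/
theorem Valuation.exists_map_sum_eq {R Γ₀ ι : Type*} [Ring R] [LinearOrderedCommGroupWithZero Γ₀]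
    (v : Valuation R Γ₀) (s : Finset ι) (hs : s.Nonempty) (g : ι → R)
    (hinj : ∀ i ∈ s, ∀ j ∈ s, v (g i) = v (g j) → i = j) :
    ∃ i ∈ s, v (∑ j ∈ s, g j) = v (g i) := by
  classical
  obtain ⟨i, hi, hmax⟩ := s.exists_max_image (fun i => v (g i)) hs
  refine ⟨i, hi, v.map_sum_eq_of_lt hi fun j hj => ?_⟩
  rw [Finset.mem_sdiff, Finset.mem_singleton] at hj
  exact lt_of_le_of_ne (hmax j hj.1) fun h => hj.2 (hinj j hj.1 i hi h)

/-- A valuation ring of a field, pulled back along a field embedding `σ`, is dominated by a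
valuation ring of any given extension. -/
theorem exists_valuationSubring_dominating {M F E : Type*} [Field M] [Field F] [Field E]
    [Algebra M E] (σ : M →+* F) (W : ValuationSubring F) :
    ∃ O : ValuationSubring E,
      (∀ m : M, W.valuation (σ m) ≤ 1 → O.valuation (algebraMap M E m) ≤ 1) ∧
      (∀ m : M, W.valuation (σ m) < 1 → O.valuation (algebraMap M E m) < 1) := by
  set A : ValuationSubring M := W.comap σ with hA
  obtain ⟨O, hO, hloc⟩ :=
    (A.toLocalSubring.map (algebraMap M E)).exists_le_valuationSubring
  have hmem : ∀ m : M, W.valuation (σ m) ≤ 1 → algebraMap M E m ∈ O := fun m hm =>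
    hO ⟨m, (W.valuation_le_one_iff _).1 hm, rfl⟩
  refine ⟨O, fun m hm => (O.valuation_le_one_iff _).2 (hmem m hm), fun m hm => ?_⟩
  refine lt_of_le_of_ne ((O.valuation_le_one_iff _).2 (hmem m hm.le)) fun h1 => ?_
  have hu : IsUnit (⟨algebraMap M E m, hmem m hm.le⟩ : O) :=
    (O.valuation_eq_one_iff _).2 h1
  have hmA : algebraMap M E m ∈ (A.toLocalSubring.map (algebraMap M E)).toSubring :=
    ⟨m, (W.valuation_le_one_iff _).1 hm.le, rfl⟩
  obtain ⟨w, hw⟩ := isUnit_iff_exists_inv.1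
    (hloc.map_nonunit ⟨algebraMap M E m, hmA⟩ hu)
  obtain ⟨w, m', hm', rfl⟩ := w
  have e : algebraMap M E (m * m') = 1 := by
    rw [map_mul]; exact congrArg Subtype.val hw
  have e' : m * m' = 1 := (algebraMap M E).injective (by rw [e, map_one])
  have hm'' : W.valuation (σ m') ≤ 1 := (W.valuation_le_one_iff _).2 hm'
  have : W.valuation (σ m) * W.valuation (σ m') = 1 := by
    rw [← map_mul, ← map_mul, e', map_one, map_one]
  have h2 := mul_lt_one_of_lt_of_le hm hm''
  rw [this] at h2
  exact lt_irrefl _ h2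

/-- A valuation ring of an extension `E` of `K` whose value group is free with the values of
`x₁, …, x_d` as a basis, and whose residue field has finite degree `f` over `K`, the residue
classes of `y₁, …, y_f` being a basis. The residue field is not mentioned: that the classes are
independent is `val_comb`, and that they span is `exists_comb`. -/
structure MonomialFrame (K E : Type*) [Field K] [Field E] [Algebra K E] (d f : ℕ) where
  /-- The valuation ring. -/
  O : ValuationSubring E
  /-- Elements whose values form a basis of the value group. -/
  x : Fin d → Eˣ
  /-- Elements whose classes form a basis of the residue field. -/
  y : Fin f → E
  exists_val_eq : ∀ z : E, z ≠ 0 → ∃ α : Fin d → ℤ, O.valuation z =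
    O.valuation ((∏ i, x i ^ α i : Eˣ) : E)
  eq_zero_of_val_eq_one : ∀ α : Fin d → ℤ, O.valuation ((∏ i, x i ^ α i : Eˣ) : E) = 1 → α = 0
  val_comb : ∀ c : Fin f → K, c ≠ 0 → O.valuation (∑ j, c j • y j) = 1
  exists_comb : ∀ z : E, O.valuation z ≤ 1 →
    ∃ c : Fin f → K, O.valuation (z - ∑ j, c j • y j) < 1

variable {K M E : Type*} [Field K] [Field M] [Field E] [Algebra M E]

/-- In an extension of finite degree `r`, some power `z ^ j` with `1 ≤ j ≤ r` of each nonzero `z`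
has the value of an element of the base field. -/
theorem exists_pow_val_eq [FiniteDimensional M E] (O : ValuationSubring E) {z : E} (hz : z ≠ 0) :
    ∃ j : ℕ, 1 ≤ j ∧ j ≤ Module.finrank M E ∧ ∃ m : M, m ≠ 0 ∧
      O.valuation (z ^ j) = O.valuation (algebraMap M E m) := by
  classical
  set r := Module.finrank M E
  -- A linear relation between the powers of `z` must contain two terms of the same value.
  have hdep : ¬ LinearIndependent M fun i : Fin (r + 1) => z ^ (i : ℕ) := fun h => by
    have := h.fintype_card_le_finrank
    simp [r] at this
  rw [Fintype.not_linearIndependent_iff] at hdep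
  obtain ⟨g, hg, i₀, hi₀⟩ := hdep
  have hsum : ∑ i ∈ Finset.univ.filter (fun i => g i ≠ 0), g i • z ^ (i : ℕ) = 0 := by
    rw [← hg]
    refine Finset.sum_subset (Finset.filter_subset _ _) fun i _ hi => ?_
    have : g i = 0 := by simpa using hi
    simp [this]
  have h0 : ∀ i ∈ Finset.univ.filter (fun i => g i ≠ 0),
      O.valuation (g i • z ^ (i : ℕ)) ≠ 0 := by
    intro i hi
    rw [Finset.mem_filter] at hi
    rw [Valuation.ne_zero_iff]
    exact smul_ne_zero hi.2 (pow_ne_zero _ hz)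
  have hninj : ¬ ∀ i ∈ Finset.univ.filter (fun i => g i ≠ 0),
      ∀ j ∈ Finset.univ.filter (fun i => g i ≠ 0),
      O.valuation (g i • z ^ (i : ℕ)) = O.valuation (g j • z ^ (j : ℕ)) → i = j := by
    intro hinj
    obtain ⟨i, hi, h⟩ := Valuation.exists_map_sum_eq O.valuation _
      ⟨i₀, by simpa using hi₀⟩ _ hinj
    rw [hsum, map_zero] at h
    exact h0 i hi h.symm
  push Not at hninj
  obtain ⟨i, hi, j, hj, hv, hij⟩ := hninj
  wlog hlt : i < j generalizing i j
  · exact this j hj i hi hv.symm hij.symm (lt_of_le_of_ne (not_lt.1 hlt) hij.symm)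
  rw [Finset.mem_filter] at hi hj
  refine ⟨j - i, ?_, ?_, g i * (g j)⁻¹, mul_ne_zero hi.2 (inv_ne_zero hj.2), ?_⟩
  · have : (i : ℕ) < j := hlt
    omega
  · have := j.2
    omega
  · have hvj : O.valuation (algebraMap M E (g j)) ≠ 0 := by
      rw [Valuation.ne_zero_iff]; simpa using hj.2
    have hvz : O.valuation z ^ (i : ℕ) ≠ 0 := pow_ne_zero _ ((Valuation.ne_zero_iff _).2 hz)
    rw [Algebra.smul_def, Algebra.smul_def, map_mul, map_mul, map_pow, map_pow] at hv
    rw [map_mul, map_inv₀, map_mul, map_inv₀, map_pow, eq_mul_inv_iff_mul_eq₀ hvj]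
    apply mul_left_cancel₀ hvz
    rw [← mul_assoc, ← pow_add, Nat.add_sub_cancel' (le_of_lt hlt), mul_comm (_ ^ (i : ℕ)), hv,
      mul_comm]

variable {d : ℕ}

theorem val_prod_zpow (O : ValuationSubring E) (x : Fin d → Eˣ) (α : Fin d → ℤ) :
    Units.map (O.valuation : E →* O.ValueGroup) (∏ i, x i ^ α i) =
      Additive.toMul (Fintype.linearCombination ℤ (fun i =>
        Additive.ofMul (Units.map (O.valuation : E →* O.ValueGroup) (x i))) α) := by
  simp [Fintype.linearCombination_apply, toMul_sum]

/-- If the monomials in `x₁, …, x_d` represent all values of a subfield of finite index, and do so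
without repetition, then the value group of the extension is free of rank `d`. -/
theorem exists_value_basis [FiniteDimensional M E] (O : ValuationSubring E) (x : Fin d → Eˣ)
    (h2 : ∀ m : M, m ≠ 0 → ∃ α : Fin d → ℤ, O.valuation (algebraMap M E m) =
      O.valuation ((∏ i, x i ^ α i : Eˣ) : E))
    (h3 : ∀ α : Fin d → ℤ, O.valuation ((∏ i, x i ^ α i : Eˣ) : E) = 1 → α = 0) :
    ∃ x' : Fin d → Eˣ,
      (∀ z : E, z ≠ 0 → ∃ α : Fin d → ℤ, O.valuation z =
        O.valuation ((∏ i, x' i ^ α i : Eˣ) : E)) ∧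
      (∀ α : Fin d → ℤ, O.valuation ((∏ i, x' i ^ α i : Eˣ) : E) = 1 → α = 0) := by
  set V : Eˣ →* (O.ValueGroup)ˣ := Units.map (O.valuation : E →* O.ValueGroup) with hV
  have hVs : Function.Surjective V := by
    intro γ
    obtain ⟨z, hz⟩ := O.valuation_surjective γ
    have hz0 : z ≠ 0 := by
      rintro rfl
      exact γ.ne_zero (by rw [← hz, map_zero])
    exact ⟨Units.mk0 z hz0, Units.ext hz⟩
  let Λ := Additive (O.ValueGroup)ˣ
  set φ : (Fin d → ℤ) →ₗ[ℤ] Λ :=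
    Fintype.linearCombination ℤ (fun i => Additive.ofMul (V (x i))) with hφ
  have hφv : ∀ α, V (∏ i, x i ^ α i) = Additive.toMul (φ α) := fun α => val_prod_zpow O x α
  have hφi : Function.Injective φ := by
    rw [injective_iff_map_eq_zero]
    intro α hα
    apply h3
    have := hφv α
    rw [hα] at this
    exact congrArg Units.val this
  -- Multiplication by `N` embeds the value group of the extension in that of the subfield.
  set N := (Module.finrank M E).factorial with hN
  have hNpos : N ≠ 0 := Nat.factorial_ne_zero _
  have hrange : ∀ l : Λ, N • l ∈ LinearMap.range φ := by
    intro l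
    obtain ⟨u, hu⟩ := hVs (Additive.toMul l)
    obtain ⟨j, hj1, hj2, m, hm0, hm⟩ := exists_pow_val_eq (M := M) O u.ne_zero
    obtain ⟨α, hα⟩ := h2 m hm0
    have hjl : j • l ∈ LinearMap.range φ := by
      refine ⟨α, ?_⟩
      apply Additive.toMul.injective
      rw [← hφv, toMul_nsmul, ← hu, ← map_pow]
      apply Units.ext
      change O.valuation _ = O.valuation _
      rw [Units.val_pow_eq_pow_val, hm, hα]
    obtain ⟨t, ht⟩ := Nat.dvd_factorial hj1 hj2
    rw [hN, ht, mul_comm, mul_smul]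
    exact (LinearMap.range φ).smul_of_tower_mem t hjl
  set μ : Λ →ₗ[ℤ] LinearMap.range φ :=
    (LinearMap.lsmul ℤ Λ (N : ℤ)).codRestrict _ (fun l => by simpa using hrange l) with hμ
  have hμi : Function.Injective μ := by
    rw [injective_iff_map_eq_zero]
    intro l hl
    have h1 : (N : ℤ) • l = 0 := congrArg Subtype.val hl
    rw [natCast_zsmul] at h1
    exact (nsmul_eq_zero_iff_right hNpos).1 h1
  have : Module.Finite ℤ Λ := Module.Finite.of_injective μ hμi
  have : Module.Free ℤ Λ := inferInstance
  have hrank : Module.finrank ℤ Λ = d := by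
    apply le_antisymm
    · refine (LinearMap.finrank_le_finrank_of_injective hμi).trans ?_
      rw [LinearMap.finrank_range_of_inj hφi]
      simp
    · have := LinearMap.finrank_le_finrank_of_injective hφi
      simpa using this
  let b : Module.Basis (Fin d) ℤ Λ := Module.finBasisOfFinrankEq ℤ Λ hrank
  choose x' hx' using fun i => hVs (Additive.toMul (b i))
  have hb : ∀ α : Fin d → ℤ, V (∏ i, x' i ^ α i) = Additive.toMul (∑ i, α i • b i) := by
    intro α
    rw [hV, val_prod_zpow O x' α, Fintype.linearCombination_apply]
    congr 1
    refine Finset.sum_congr rfl fun i _ => ?_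
    rw [← hV, hx']
    rfl
  refine ⟨x', fun z hz => ⟨b.repr (Additive.ofMul (V (Units.mk0 z hz))), ?_⟩, fun α hα => ?_⟩
  · have := hb (b.repr (Additive.ofMul (V (Units.mk0 z hz))))
    rw [b.sum_repr] at this
    exact (congrArg Units.val this).symm
  · have h1 : V (∏ i, x' i ^ α i) = 1 := Units.ext hα
    rw [hb] at h1
    have h4 : ∑ i, α i • b i = 0 := Additive.toMul.injective h1
    funext i
    exact Fintype.linearIndependent_iff.1 b.linearIndependent α h4 i

variable [Algebra K E]

/-- If the residue field of a subfield `M` of finite index is `K`, then the residue field of the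
extension has a finite basis over `K`. -/
theorem exists_residue_basis [FiniteDimensional M E] (O : ValuationSubring E)
    (h1 : ∀ c : K, c ≠ 0 → O.valuation (algebraMap K E c) = 1)
    (h4 : ∀ m : M, O.valuation (algebraMap M E m) ≤ 1 →
      ∃ c : K, O.valuation (algebraMap M E m - algebraMap K E c) < 1) :
    ∃ (f : ℕ) (y : Fin f → E),
      (∀ c : Fin f → K, c ≠ 0 → O.valuation (∑ j, c j • y j) = 1) ∧
      ∀ z : E, O.valuation z ≤ 1 →
        ∃ c : Fin f → K, O.valuation (z - ∑ j, c j • y j) < 1 := by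
  set v := O.valuation with hv
  -- A longest family with independent residue classes is the basis; elements whose residue classes
  -- are independent over `K` are independent over `M`, which bounds the length.
  let Good : ℕ → Prop := fun n => ∃ y : Fin n → E,
    ∀ c : Fin n → K, c ≠ 0 → v (∑ j, c j • y j) = 1
  have h0 : Good 0 := ⟨Fin.elim0, fun c hc => absurd (Subsingleton.elim _ _) hc⟩
  have hle : ∀ n, Good n → n ≤ Module.finrank M E := by
    rintro n ⟨y, hy⟩
    have hy1 : ∀ i, v (y i) = 1 := by
      intro i
      have := hy (Pi.single i 1) (by simp)
      rw [Finset.sum_eq_single i (by intro j _ hj; simp [hj]) (by simp)] at this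
      simpa using this
    have hli : LinearIndependent M y := by
      rw [Fintype.linearIndependent_iff]
      by_contra hc
      push Not at hc
      obtain ⟨g, hg, i, hi⟩ := hc
      -- Divide a relation by a coefficient of maximal value and reduce it to the residue field.
      obtain ⟨i₀, -, hmax⟩ := Finset.univ.exists_max_image
        (fun i => v (algebraMap M E (g i))) ⟨i, Finset.mem_univ _⟩
      have hg0 : g i₀ ≠ 0 := by
        intro h
        have := hmax i (Finset.mem_univ _)
        rw [h, map_zero, map_zero, le_zero_iff, Valuation.zero_iff] at this
        exact hi (by simpa using this)
      have hvg : 0 < v (algebraMap M E (g i₀)) := by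
        rw [zero_lt_iff, Valuation.ne_zero_iff]; simpa using hg0
      have hh : ∀ i, v (algebraMap M E (g i / g i₀)) ≤ 1 := by
        intro i
        rw [map_div₀, map_div₀]
        exact div_le_one_of_le₀ (hmax i (Finset.mem_univ _)) zero_le
      choose c hc using fun i => h4 _ (hh i)
      have hc0 : c ≠ 0 := by
        intro h
        have := hc i₀
        simp [h, hg0] at this
      have hsum : ∑ i, c i • y i =
          -∑ i, (algebraMap M E (g i / g i₀) - algebraMap K E (c i)) * y i := by
        have e : ∑ i, algebraMap M E (g i / g i₀) * y i = 0 := by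
          have : ∑ i, algebraMap M E (g i / g i₀) * y i =
              algebraMap M E (g i₀)⁻¹ * ∑ i, g i • y i := by
            rw [Finset.mul_sum]
            refine Finset.sum_congr rfl fun i _ => ?_
            rw [Algebra.smul_def, ← mul_assoc, ← map_mul, mul_comm (g i₀)⁻¹, div_eq_mul_inv]
          rw [this, hg, mul_zero]
        simp only [sub_mul, Finset.sum_sub_distrib, e, Algebra.smul_def, zero_sub, neg_neg]
      have h5 := hy c hc0
      rw [hsum, Valuation.map_neg] at h5
      refine absurd h5 (ne_of_lt ?_)
      refine v.map_sum_lt one_ne_zero fun i _ => ?_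
      rw [map_mul, hy1, mul_one]
      exact hc i
    simpa using hli.fintype_card_le_finrank
  obtain ⟨n, ⟨y, hy⟩, hn⟩ : ∃ n, Good n ∧ ¬ Good (n + 1) := by
    by_contra hc
    push Not at hc
    have : ∀ n, Good n := fun n => Nat.rec h0 (fun n ih => hc n ih) n
    have := hle _ (this (Module.finrank M E + 1))
    omega
  have hy' : ∀ c : Fin n → K, v (∑ j, c j • y j) ≤ 1 := by
    intro c
    by_cases hc : c = 0
    · simp [hc]
    · exact (hy c hc).le
  refine ⟨n, y, hy, fun z hz => ?_⟩
  by_contra hcon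
  push Not at hcon
  apply hn
  refine ⟨Fin.cons z y, fun c hc => ?_⟩
  rw [Fin.sum_univ_succ]
  simp only [Fin.cons_zero, Fin.cons_succ]
  by_cases hc0 : c 0 = 0
  · rw [hc0, zero_smul, zero_add]
    apply hy fun j => c j.succ
    intro h
    apply hc
    funext j
    refine Fin.cases hc0 (fun j => ?_) j
    exact congrFun h j
  · have e : c 0 • z + ∑ j : Fin n, c j.succ • y j =
        algebraMap K E (c 0) * (z - ∑ j : Fin n, (-(c 0)⁻¹ * c j.succ) • y j) := by
      rw [mul_sub, Finset.mul_sum, ← Algebra.smul_def, sub_eq_add_neg, ← Finset.sum_neg_distrib]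
      congr 1
      refine Finset.sum_congr rfl fun j _ => ?_
      rw [← Algebra.smul_def, smul_smul, ← mul_assoc, mul_neg, mul_inv_cancel₀ hc0, neg_one_mul,
        neg_smul, neg_neg]
    rw [e, map_mul, h1 _ hc0, one_mul]
    refine le_antisymm ?_ (hcon _)
    exact (v.map_sub _ _).trans (max_le hz (hy' _))

/-- A field of finite degree over the rational function field in `x₁, …, x_d` has a monomial frame
of rank `d`: the lexicographic monomial valuation is extended to it. -/
theorem exists_monomialFrame {x : Fin d → E} (hx : AlgebraicIndependent K x)
    [FiniteDimensional (IntermediateField.adjoin K (Set.range x)) E] :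
    ∃ f : ℕ, Nonempty (MonomialFrame K E d f) := by
  let M := IntermediateField.adjoin K (Set.range x)
  let Γ := Lex (Fin d → ℤ)
  let e : Fin d → Γ := fun i => toLex (Pi.single i 1)
  have hcomb : ∀ α : Fin d → ℤ, ∑ i, α i • e i = toLex α := by
    intro α
    -- `Lex` is a type synonym, so the sum may be computed in `Fin d → ℤ`.
    change (∑ i, α i • (Pi.single i 1 : Fin d → ℤ)) = α
    funext j
    simp [Finset.sum_apply, Pi.single_apply]
  have he : Function.Injective fun m : Fin d →₀ ℕ => m.sum fun i k => k • e i := by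
    intro m m' h
    have key : ∀ m : Fin d →₀ ℕ, (m.sum fun i k => k • e i) = toLex fun i => (m i : ℤ) := by
      intro m
      rw [Finsupp.sum_fintype _ _ (by simp), ← hcomb]
      simp
    simp only [key] at h
    ext i
    have := congrFun (toLex.injective h) i
    exact_mod_cast this
  -- `σ` embeds the rational function field in the Hahn series over `ℤ ^ d` with the lexicographic
  -- order, sending `xᵢ` to the monomial of exponent the `i`-th basis vector.
  let τ : FractionRing (MvPolynomial (Fin d) K) →+* HahnSeries Γ K :=
    IsFractionRing.lift (g := (MvPolynomial.aeval (R := K)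
      fun i => (HahnSeries.single (e i) (1 : K))).toRingHom) (aeval_single_injective e he)
  let σ : M →+* HahnSeries Γ K := τ.comp (hx.aevalEquivField.symm : M ≃+* _).toRingHom
  have hσ : ∀ p : MvPolynomial (Fin d) K,
      σ (hx.aevalEquivField (algebraMap (MvPolynomial (Fin d) K) _ p)) =
      MvPolynomial.aeval (R := K) (fun i => (HahnSeries.single (e i) (1 : K))) p := by
    intro p
    simp [σ, τ]
  let X : Fin d → M := fun i => ⟨x i, IntermediateField.subset_adjoin _ _ ⟨i, rfl⟩⟩
  have hσX : ∀ i, σ (X i) = HahnSeries.single (e i) 1 := by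
    intro i
    have : X i = hx.aevalEquivField (algebraMap (MvPolynomial (Fin d) K) _ (MvPolynomial.X i)) := by
      apply Subtype.ext
      rw [hx.aevalEquivField_algebraMap_apply_coe, MvPolynomial.aeval_X]
    rw [this, hσ, MvPolynomial.aeval_X]
  have hσC : ∀ c : K, σ (algebraMap K M c) = HahnSeries.C c := by
    intro c
    have : algebraMap K M c =
        hx.aevalEquivField (algebraMap (MvPolynomial (Fin d) K) _ (MvPolynomial.C c)) := by
      apply Subtype.ext
      rw [hx.aevalEquivField_algebraMap_apply_coe, MvPolynomial.aeval_C]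
      rfl
    rw [this, hσ, MvPolynomial.aeval_C, HahnSeries.algebraMap_apply]
    simp
  have hX0 : ∀ i, X i ≠ 0 := by
    intro i h
    have := hσX i
    rw [h, map_zero] at this
    exact HahnSeries.single_ne_zero one_ne_zero this.symm
  have hσmon : ∀ α : Fin d → ℤ, σ (∏ i, X i ^ α i) = HahnSeries.single (toLex α) 1 := by
    intro α
    rw [map_prod, ← hcomb]
    induction (Finset.univ : Finset (Fin d)) using Finset.cons_induction with
    | empty => simp
    | cons a s ha ih =>
      rw [Finset.prod_cons, Finset.sum_cons, ih, map_zpow₀, hσX, single_one_zpow,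
        HahnSeries.single_mul_single, one_mul]
  set W := hahnInteger Γ K with hW
  obtain ⟨O, hO1, hO2⟩ := exists_valuationSubring_dominating (E := E) σ W
  -- Domination makes the two valuations agree on which elements of `M` are units or integral.
  have hO3 : ∀ m : M, W.valuation (σ m) = 1 → O.valuation (algebraMap M E m) = 1 := by
    intro m hm
    refine le_antisymm (hO1 m hm.le) ?_
    have h := hO1 m⁻¹ (by rw [map_inv₀, map_inv₀, hm, inv_one])
    rw [map_inv₀, map_inv₀] at h
    have h0 : 0 < O.valuation (algebraMap M E m) := by
      rw [zero_lt_iff, Valuation.ne_zero_iff]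
      intro h0
      have : m = 0 := by simpa using h0
      rw [this, map_zero, map_zero] at hm
      exact zero_ne_one hm
    exact (inv_le_one₀ h0).1 h
  have hO4 : ∀ m : M, O.valuation (algebraMap M E m) ≤ 1 → W.valuation (σ m) ≤ 1 := by
    intro m hm
    by_contra hc
    push Not at hc
    have h := hO2 m⁻¹ (by
      rw [map_inv₀, map_inv₀]; exact inv_lt_one_of_one_lt₀ hc)
    rw [map_inv₀, map_inv₀] at h
    have h0 : 0 < O.valuation (algebraMap M E m) := by
      rw [zero_lt_iff, Valuation.ne_zero_iff]
      intro h0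
      have : m = 0 := by simpa using h0
      rw [this, map_zero, map_zero] at hc
      exact not_lt_zero hc
    exact absurd ((inv_lt_one₀ h0).1 h) (not_lt.2 hm)
  have hx0 : ∀ i, x i ≠ 0 := fun i h => hX0 i (Subtype.ext h)
  let xu : Fin d → Eˣ := fun i => Units.mk0 (x i) (hx0 i)
  have hxu : ∀ α : Fin d → ℤ, ((∏ i, xu i ^ α i : Eˣ) : E) =
      algebraMap M E (∏ i, X i ^ α i) := by
    intro α
    rw [map_prod, Units.coe_prod]
    refine Finset.prod_congr rfl fun i _ => ?_
    rw [map_zpow₀, Units.val_zpow_eq_zpow_val]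
    rfl
  obtain ⟨x', hx1, hx2⟩ := exists_value_basis (M := M) O xu (by
    intro m hm
    obtain ⟨g, hg⟩ := exists_valuation_eq_single (K := K)
      (z := σ m) (by simpa using hm)
    refine ⟨-ofLex g, ?_⟩
    have hn0 : O.valuation (algebraMap M E (∏ i, X i ^ (-ofLex g) i)) ≠ 0 := by
      rw [← hxu, Valuation.ne_zero_iff]; exact Units.ne_zero _
    have h1 : O.valuation (algebraMap M E (m * (∏ i, X i ^ (ofLex g) i))) = 1 := by
      apply hO3
      rw [map_mul, hσmon]
      exact hg
    rw [hxu]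
    have h2 : (∏ i, X i ^ (-ofLex g) i) = (∏ i, X i ^ (ofLex g) i)⁻¹ := by
      rw [← Finset.prod_inv_distrib]
      refine Finset.prod_congr rfl fun i _ => ?_
      rw [Pi.neg_apply, zpow_neg]
    rw [h2, map_inv₀, map_inv₀]
    rw [map_mul, map_mul] at h1
    exact eq_inv_of_mul_eq_one_left h1) (by
    intro α hα
    rw [hxu] at hα
    have h1 : W.valuation (σ (∏ i, X i ^ α i)) ≤ 1 := hO4 _ hα.le
    have h2 : W.valuation (σ (∏ i, X i ^ (-α) i)) ≤ 1 := by
      apply hO4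
      have : (∏ i, X i ^ (-α) i) = (∏ i, X i ^ α i)⁻¹ := by
        rw [← Finset.prod_inv_distrib]
        refine Finset.prod_congr rfl fun i _ => ?_
        rw [Pi.neg_apply, zpow_neg]
      rw [this, map_inv₀, map_inv₀, hα, inv_one]
    rw [hσmon, ValuationSubring.valuation_le_one_iff, single_mem_hahnInteger] at h1 h2
    have h3 : toLex α = 0 := le_antisymm (by simpa using h2) h1
    exact toLex.injective h3)
  obtain ⟨f, y, hy1, hy2⟩ := exists_residue_basis (K := K) (M := M) O (by
    intro c hc
    have h1 : O.valuation (algebraMap M E (algebraMap K M c)) ≤ 1 := by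
      apply hO1
      rw [hσC, ValuationSubring.valuation_le_one_iff, mem_hahnInteger, HahnSeries.C_apply]
      exact HahnSeries.orderTop_single_le
    have h2 : O.valuation (algebraMap M E (algebraMap K M c⁻¹)) ≤ 1 := by
      apply hO1
      rw [hσC, ValuationSubring.valuation_le_one_iff, mem_hahnInteger, HahnSeries.C_apply]
      exact HahnSeries.orderTop_single_le
    rw [← IsScalarTower.algebraMap_apply] at h1 h2
    refine le_antisymm h1 ?_
    rw [map_inv₀, map_inv₀] at h2
    exact (inv_le_one₀ (by
      rw [zero_lt_iff, Valuation.ne_zero_iff]; simpa using hc)).1 h2) (by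
    intro m hm
    obtain ⟨c, hc⟩ := exists_valuation_sub_C_lt_one (K := K) (Γ := Γ) (z := σ m)
      ((W.valuation_le_one_iff _).1 (hO4 m hm))
    refine ⟨c, ?_⟩
    rw [IsScalarTower.algebraMap_apply K M E, ← map_sub]
    apply hO2
    rw [map_sub, hσC]
    exact hc)
  exact ⟨f, ⟨⟨O, x', y, hx1, hx2, hy1, hy2⟩⟩⟩

end Valuations

/-! ### Independence through distinct values -/

namespace MonomialFrame

variable {K E : Type*} [Field K] [Field E] [Algebra K E] {d f : ℕ} (Φ : MonomialFrame K E d f)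

theorem val_y (j : Fin f) : Φ.O.valuation (Φ.y j) = 1 := by
  have := Φ.val_comb (Pi.single j 1) (by simp)
  rw [Finset.sum_eq_single j (by intro i _ hi; simp [hi]) (by simp)] at this
  simpa using this

/-- The valuation is trivial on the ground field. -/
theorem val_algebraMap {c : K} (hc : c ≠ 0) : Φ.O.valuation (algebraMap K E c) = 1 := by
  obtain ⟨c', hc'⟩ := Φ.exists_comb 1 (by simp)
  rcases Nat.eq_zero_or_pos f with h | h
  · subst h
    simp at hc'
  · have := Φ.val_comb (Pi.single ⟨0, h⟩ c) (by simpa using hc)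
    rw [Finset.sum_eq_single ⟨0, h⟩ (by intro i _ hi; simp [hi]) (by simp)] at this
    simpa [Algebra.smul_def, Φ.val_y] using this

theorem val_smul_le (c : K) (z : E) : Φ.O.valuation (c • z) ≤ Φ.O.valuation z := by
  by_cases hc : c = 0
  · simp [hc]
  · rw [Algebra.smul_def, map_mul, Φ.val_algebraMap hc, one_mul]

theorem val_smul {c : K} (hc : c ≠ 0) (z : E) : Φ.O.valuation (c • z) = Φ.O.valuation z := by
  rw [Algebra.smul_def, map_mul, Φ.val_algebraMap hc, one_mul]

/-- The Laurent monomial of exponent `α` in the elements `x₁, …, x_d`. -/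
def mon (α : Fin d → ℤ) : E := ((∏ i, Φ.x i ^ α i : Eˣ) : E)

theorem mon_ne_zero (α : Fin d → ℤ) : Φ.mon α ≠ 0 := Units.ne_zero _

theorem mon_add (α β : Fin d → ℤ) : Φ.mon (α + β) = Φ.mon α * Φ.mon β := by
  simp only [mon, Pi.add_apply, zpow_add, Finset.prod_mul_distrib, Units.val_mul]

theorem mon_nsmul (k : ℕ) (α : Fin d → ℤ) : Φ.mon (k • α) = Φ.mon α ^ k := by
  induction k with
  | zero => simp [mon]
  | succ k ih => rw [succ_nsmul, mon_add, ih, pow_succ]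

theorem mon_injective : Function.Injective fun α => Φ.O.valuation (Φ.mon α) := by
  intro α β h
  have h1 : Φ.O.valuation (Φ.mon (α - β)) = 1 := by
    have h2 : Φ.mon α = Φ.mon (α - β) * Φ.mon β := by rw [← mon_add, sub_add_cancel]
    have h3 : Φ.O.valuation (Φ.mon β) ≠ 0 := (Valuation.ne_zero_iff _).2 (Φ.mon_ne_zero β)
    simp only at h
    rw [h2, map_mul] at h
    exact (mul_eq_right₀ h3).1 h
  exact sub_eq_zero.1 (Φ.eq_zero_of_val_eq_one _ h1)

/-- The `K`-subspace of elements of value less than `γ`. -/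
def ltSubmodule (γ : Φ.O.ValueGroup) (hγ : γ ≠ 0) : Submodule K E where
  carrier := {z | Φ.O.valuation z < γ}
  add_mem' ha hb := lt_of_le_of_lt (Φ.O.valuation.map_add _ _) (max_lt ha hb)
  zero_mem' := by simpa [zero_lt_iff] using hγ
  smul_mem' c z hz := lt_of_le_of_lt (Φ.val_smul_le c z) hz

theorem mem_ltSubmodule {γ : Φ.O.ValueGroup} {hγ : γ ≠ 0} {z : E} :
    z ∈ Φ.ltSubmodule γ hγ ↔ Φ.O.valuation z < γ := Iff.rfl

/-- The elements of value at most `γ` modulo those of value less than `γ` form a space of dimension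
at most `f`. -/
theorem finrank_le_add_of_le (W : Submodule K E) [FiniteDimensional K W] {w : E} (hw : w ≠ 0)
    (hW : ∀ z ∈ W, Φ.O.valuation z ≤ Φ.O.valuation w) :
    Module.finrank K W ≤ f + Module.finrank K
      (W ⊓ Φ.ltSubmodule (Φ.O.valuation w) ((Valuation.ne_zero_iff _).2 hw) : Submodule K E) := by
  set L := Φ.ltSubmodule (Φ.O.valuation w) ((Valuation.ne_zero_iff _).2 hw) with hL
  have h1 : Module.finrank K W = Module.finrank K (W.map L.mkQ) +
      Module.finrank K (W ⊓ L : Submodule K E) := by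
    have := LinearMap.finrank_range_add_finrank_ker (L.mkQ.domRestrict W)
    rw [← this, LinearMap.range_domRestrict, LinearMap.ker_domRestrict, Submodule.ker_mkQ]
    congr 1
    rw [← Submodule.map_comap_subtype]
    exact (Submodule.finrank_map_subtype_eq W _).symm
  set S : Submodule K E := Submodule.span K (Set.range fun j => w * Φ.y j) with hS
  have h2 : W.map L.mkQ ≤ S.map L.mkQ := by
    rintro _ ⟨z, hz, rfl⟩
    obtain ⟨c, hc⟩ := Φ.exists_comb (z / w) (by
      rw [map_div₀]; exact div_le_one_of_le₀ (hW z hz) zero_le)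
    refine ⟨∑ j, c j • (w * Φ.y j), Submodule.sum_mem _ fun j _ => Submodule.smul_mem _ _
      (Submodule.subset_span ⟨j, rfl⟩), ?_⟩
    rw [← sub_eq_zero, ← map_sub, Submodule.mkQ_apply, Submodule.Quotient.mk_eq_zero,
      ← Submodule.neg_mem_iff, neg_sub, mem_ltSubmodule]
    have e : z - ∑ j, c j • (w * Φ.y j) = w * (z / w - ∑ j, c j • Φ.y j) := by
      rw [mul_sub, mul_div_cancel₀ _ hw, Finset.mul_sum]
      simp only [mul_smul_comm]
    rw [e, map_mul]
    have h0 : 0 < Φ.O.valuation w := zero_lt_iff.2 ((Valuation.ne_zero_iff _).2 hw)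
    exact mul_lt_of_lt_one_right h0 hc
  have : FiniteDimensional K S := FiniteDimensional.span_of_finite K (Set.finite_range _)
  have h3 : Module.finrank K (W.map L.mkQ) ≤ f :=
    (Submodule.finrank_mono h2).trans ((Submodule.finrank_map_le _ _).trans
      ((finrank_range_le_card (R := K) fun j => w * Φ.y j).trans (by simp)))
  omega

/-- A space that takes only the values in `T` has dimension at most `f * T.card`: pass from the
largest value to the next one. -/
theorem finrank_le_of_values (T : Finset Φ.O.ValueGroup) (W : Submodule K E)
    [FiniteDimensional K W] (hT : ∀ w ∈ W, w ≠ 0 → Φ.O.valuation w ∈ T) :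
    Module.finrank K W ≤ f * T.card := by
  classical
  induction h : T.card generalizing T W with
  | zero =>
    rw [Finset.card_eq_zero] at h
    subst h
    have : W = ⊥ := by
      rw [Submodule.eq_bot_iff]
      intro w hw
      by_contra hw0
      simpa using hT w hw hw0
    subst this
    simp
  | succ n ih =>
    obtain ⟨γ, hγ, hmax⟩ := T.exists_max_image id (Finset.card_pos.1 (by omega))
    by_cases hw : ∃ w ∈ W, w ≠ 0 ∧ Φ.O.valuation w = γ
    · obtain ⟨w, hwW, hw0, hwγ⟩ := hw
      have h1 := Φ.finrank_le_add_of_le W hw0 fun z hz => by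
        by_cases hz0 : z = 0
        · simp [hz0]
        · rw [hwγ]; exact hmax _ (hT z hz hz0)
      have := Submodule.finiteDimensional_of_le (K := K) (inf_le_left :
        W ⊓ Φ.ltSubmodule (Φ.O.valuation w) ((Valuation.ne_zero_iff _).2 hw0) ≤ W)
      have h2 := ih (T.erase γ) (W ⊓ Φ.ltSubmodule (Φ.O.valuation w)
        ((Valuation.ne_zero_iff _).2 hw0)) (by
          rintro z ⟨hz1, hz2⟩ hz0
          rw [Finset.mem_erase]
          refine ⟨?_, hT z hz1 hz0⟩
          rw [← hwγ]
          exact ne_of_lt hz2) (by rw [Finset.card_erase_of_mem hγ, h]; rfl)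
      rw [mul_add, mul_one]
      omega
    · push Not at hw
      have h2 := ih (T.erase γ) W (by
          intro z hz1 hz0
          rw [Finset.mem_erase]
          exact ⟨hw z hz1 hz0, hT z hz1 hz0⟩) (by rw [Finset.card_erase_of_mem hγ, h]; rfl)
      exact h2.trans (Nat.mul_le_mul_left _ (Nat.le_succ n))

/-- Elements of distinct values are linearly independent over the ground field. -/
theorem linearIndependent_of_injOn (t : Finset E) (h0 : ∀ z ∈ t, z ≠ 0)
    (ht : Set.InjOn Φ.O.valuation t) : LinearIndependent K ((↑) : t → E) := by
  rw [Fintype.linearIndependent_iff]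
  by_contra hc
  push Not at hc
  classical
  obtain ⟨g, hg, i, hi⟩ := hc
  have hv : ∀ j, g j ≠ 0 → Φ.O.valuation (g j • (j : E)) = Φ.O.valuation (j : E) :=
    fun j hj => Φ.val_smul hj _
  obtain ⟨j, hj, h⟩ := Valuation.exists_map_sum_eq Φ.O.valuation
    (Finset.univ.filter fun j => g j ≠ 0) ⟨i, by simpa using hi⟩ (fun j => g j • (j : E)) (by
      intro a ha b hb hab
      rw [Finset.mem_filter] at ha hb
      rw [hv _ ha.2, hv _ hb.2] at hab
      exact Subtype.ext (ht a.2 b.2 hab))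
  rw [Finset.mem_filter] at hj
  have hs : ∑ j ∈ Finset.univ.filter (fun j => g j ≠ 0), g j • (j : E) = 0 := by
    rw [← hg]
    refine Finset.sum_subset (Finset.filter_subset _ _) fun i _ hi => ?_
    have : g i = 0 := by simpa using hi
    simp [this]
  rw [hs, map_zero, hv _ hj.2] at h
  exact (Valuation.ne_zero_iff _).2 (h0 _ j.2) h.symm

/-- A finite-dimensional space takes at least `dim W / f` values; `t` contains one element for each
value. -/
theorem exists_finset_values (W : Submodule K E) [FiniteDimensional K W] :
    ∃ t : Finset E, (∀ z ∈ t, z ∈ W ∧ z ≠ 0) ∧ Set.InjOn Φ.O.valuation t ∧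
      Module.finrank K W ≤ f * t.card := by
  classical
  let Q : ℕ → Prop := fun n => ∃ t : Finset E, (∀ z ∈ t, z ∈ W ∧ z ≠ 0) ∧
    Set.InjOn Φ.O.valuation t ∧ t.card = n
  have hQ0 : Q 0 := ⟨∅, by simp, by simp, by simp⟩
  have hle : ∀ n, Q n → n ≤ Module.finrank K W := by
    rintro n ⟨t, ht, hi, rfl⟩
    have hli := Φ.linearIndependent_of_injOn t (fun z hz => (ht z hz).2) hi
    have hli' : LinearIndependent K (fun z : t => (⟨z, (ht z z.2).1⟩ : W)) :=
      LinearIndependent.of_comp W.subtype hli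
    simpa using hli'.fintype_card_le_finrank
  obtain ⟨n, ⟨t, ht, hi, rfl⟩, hn⟩ : ∃ n, Q n ∧ ¬ Q (n + 1) := by
    by_contra hc
    push Not at hc
    have : ∀ n, Q n := fun n => Nat.rec hQ0 (fun n ih => hc n ih) n
    have := hle _ (this (Module.finrank K W + 1))
    omega
  refine ⟨t, ht, hi, ?_⟩
  have h1 := Φ.finrank_le_of_values (t.image Φ.O.valuation) W (by
    intro w hw hw0
    by_contra hcon
    apply hn
    have hwt : w ∉ t := fun h => hcon (Finset.mem_image_of_mem _ h)
    refine ⟨insert w t, ?_, ?_, Finset.card_insert_of_notMem hwt⟩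
    · intro z hz
      rcases Finset.mem_insert.1 hz with rfl | hz
      · exact ⟨hw, hw0⟩
      · exact ht z hz
    · rw [Finset.coe_insert, Set.injOn_insert (by simpa using hwt)]
      refine ⟨hi, ?_⟩
      simpa using hcon)
  exact h1.trans (Nat.mul_le_mul_left _ Finset.card_image_le)

/-- If the elements of `t` have distinct values, the products of `k`-th powers of elements of `t`
with the monomials of exponents in `[0, k)^d` have distinct values, since these exponents represent
the value group modulo its `k`-th multiples. -/
theorem linearIndependent_pow_mul_mon (t : Finset E) (h0 : ∀ z ∈ t, z ≠ 0)
    (ht : Set.InjOn Φ.O.valuation t) (k : ℕ) (hk : 1 ≤ k) :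
    LinearIndependent K (fun p : (t × (Fin d → Fin k)) × Fin f =>
      (p.1.1 : E) ^ k * Φ.mon (fun i => ((p.1.2 i : ℕ) : ℤ)) * Φ.y p.2) := by
  classical
  rw [Fintype.linearIndependent_iff]
  by_contra hc
  push Not at hc
  obtain ⟨g, hg, ⟨p₀, j₀⟩, hi⟩ := hc
  set u : t × (Fin d → Fin k) → E :=
    fun p => (p.1 : E) ^ k * Φ.mon (fun i => ((p.2 i : ℕ) : ℤ)) with hu
  have hg' : ∑ p : t × (Fin d → Fin k), u p * ∑ j : Fin f, g (p, j) • Φ.y j = (0 : E) := by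
    rw [← hg, Fintype.sum_prod_type (α₁ := t × (Fin d → Fin k)) (α₂ := Fin f)]
    refine Finset.sum_congr rfl fun p _ => ?_
    rw [Finset.mul_sum]
    refine Finset.sum_congr rfl fun j _ => ?_
    rw [mul_smul_comm]
  have hu0 : ∀ p, u p ≠ 0 := fun p =>
    mul_ne_zero (pow_ne_zero _ (h0 _ p.1.2)) (Φ.mon_ne_zero _)
  have hui : ∀ p q, Φ.O.valuation (u p) = Φ.O.valuation (u q) → p = q := by
    rintro ⟨s, α⟩ ⟨s', α'⟩ h
    obtain ⟨β, hβ⟩ := Φ.exists_val_eq s (h0 _ s.2)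
    obtain ⟨β', hβ'⟩ := Φ.exists_val_eq s' (h0 _ s'.2)
    simp only [hu, map_mul, map_pow, hβ, hβ'] at h
    change Φ.O.valuation (Φ.mon β) ^ k * _ = Φ.O.valuation (Φ.mon β') ^ k * _ at h
    rw [← map_pow, ← map_pow, ← mon_nsmul, ← mon_nsmul, ← map_mul, ← map_mul, ← mon_add,
      ← mon_add] at h
    have h1 := Φ.mon_injective h
    have h2 : ∀ i, β i = β' i ∧ α i = α' i := by
      intro i
      have h3 : (k : ℤ) * β i + (α i : ℕ) = k * β' i + (α' i : ℕ) := by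
        simpa using congrFun h1 i
      have hk0 : (0 : ℤ) < k := by exact_mod_cast hk
      have e1 : (((α i : ℕ) : ℤ) + k * β i) % k = (α i : ℕ) := by
        rw [Int.add_mul_emod_self_left]
        exact Int.emod_eq_of_lt (by positivity) (by exact_mod_cast (α i).2)
      have e2 : (((α' i : ℕ) : ℤ) + k * β' i) % k = (α' i : ℕ) := by
        rw [Int.add_mul_emod_self_left]
        exact Int.emod_eq_of_lt (by positivity) (by exact_mod_cast (α' i).2)
      have e3 : ((α i : ℕ) : ℤ) = (α' i : ℕ) := by
        rw [← e1, ← e2, add_comm, h3, add_comm]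
      refine ⟨?_, Fin.ext (by exact_mod_cast e3)⟩
      rw [e3] at h3
      exact mul_left_cancel₀ hk0.ne' (add_right_cancel h3)
    have hβe : β = β' := funext fun i => (h2 i).1
    have hαe : α = α' := funext fun i => (h2 i).2
    have hs : s = s' := Subtype.ext (ht s.2 s'.2 (by rw [hβ, hβ', hβe]))
    rw [hs, hαe]
  let I := Finset.univ.filter fun p : t × (Fin d → Fin k) => (fun j => g (p, j)) ≠ 0
  have hv : ∀ p ∈ I, Φ.O.valuation (u p * ∑ j, g (p, j) • Φ.y j) = Φ.O.valuation (u p) := by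
    intro p hp
    rw [Finset.mem_filter] at hp
    rw [map_mul, Φ.val_comb _ hp.2, mul_one]
  obtain ⟨p, hp, h⟩ := Valuation.exists_map_sum_eq Φ.O.valuation I
    ⟨p₀, by
      rw [Finset.mem_filter]
      exact ⟨Finset.mem_univ _, fun h => hi (congrFun h j₀)⟩⟩
    (fun p => u p * ∑ j, g (p, j) • Φ.y j) (by
      intro a ha b hb hab
      rw [hv _ ha, hv _ hb] at hab
      exact hui _ _ hab)
  have hs : ∑ p ∈ I, u p * ∑ j, g (p, j) • Φ.y j = 0 := by
    rw [← hg']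
    refine Finset.sum_subset (Finset.filter_subset _ _) fun p _ hp => ?_
    have h1 : (fun j => g (p, j)) = 0 := by
      by_contra h
      exact hp (by rw [Finset.mem_filter]; exact ⟨Finset.mem_univ _, h⟩)
    have h2 : ∀ j, g (p, j) = 0 := fun j => congrFun h1 j
    simp [h2]
  rw [hs, map_zero, hv p hp] at h
  exact (Valuation.ne_zero_iff _).2 (hu0 p) h.symm

end MonomialFrame

/-! ### Growth of the powers of a finite-dimensional space -/

section Growth

variable {K L : Type*} [Field K]

theorem Submodule.finrank_mul_le_mul_finrank [CommRing L] [Algebra K L] (M N : Submodule K L)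
    [FiniteDimensional K M] [FiniteDimensional K N] :
    Module.finrank K (M * N : Submodule K L) ≤ Module.finrank K M * Module.finrank K N := by
  rw [← Submodule.mulMap_range, ← Module.finrank_tensorProduct]
  exact LinearMap.finrank_range_le _

/-- A crude bound, which counts the monomials of degree at most `N` in each variable. -/
theorem finrank_restrictTotalDegree_le (d N : ℕ) :
    Module.finrank K (MvPolynomial.restrictTotalDegree (Fin d) K N) ≤ (N + 1) ^ d := by
  set b : (Fin d → Fin (N + 1)) → MvPolynomial (Fin d) K := fun α =>
    MvPolynomial.monomial (Finsupp.equivFunOnFinite.symm fun i => (α i : ℕ)) 1 with hb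
  have hle : MvPolynomial.restrictTotalDegree (Fin d) K N ≤ Submodule.span K (Set.range b) := by
    intro p hp
    rw [MvPolynomial.mem_restrictTotalDegree] at hp
    rw [p.as_sum]
    refine Submodule.sum_mem _ fun m hm => ?_
    have hm' : ∀ i, m i < N + 1 := by
      intro i
      have h1 := (MvPolynomial.le_totalDegree hm).trans hp
      have h2 : m i ≤ m.sum fun _ e => e := by
        rw [Finsupp.sum_fintype _ _ (by simp)]
        exact Finset.single_le_sum (f := fun i => m i) (by simp) (Finset.mem_univ i)
      omega
    have : MvPolynomial.monomial m (p.coeff m) = p.coeff m • b fun i => ⟨m i, hm' i⟩ := by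
      rw [hb, MvPolynomial.smul_monomial, smul_eq_mul, mul_one]
      congr 1
      ext i
      simp
    rw [this]
    exact Submodule.smul_mem _ _ (Submodule.subset_span ⟨_, rfl⟩)
  have : FiniteDimensional K (Submodule.span K (Set.range b)) :=
    FiniteDimensional.span_of_finite K (Set.finite_range _)
  refine (Submodule.finrank_mono hle).trans ((finrank_range_le_card (R := K) b).trans ?_)
  simp

variable [Field L] [Algebra K L]

/-- The powers of a finite-dimensional space of elements of a finite integral extension of a
polynomial ring in `d` variables grow at most like `n ^ d`. -/
theorem exists_finrank_pow_le {d : ℕ} (R : Subalgebra K L) (V : Submodule K L)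
    [FiniteDimensional K V] (hV : V ≤ R.toSubmodule)
    (g : MvPolynomial (Fin d) K →ₐ[K] R) (hg : g.Finite) :
    ∃ C : ℕ, ∀ n : ℕ, Module.finrank K (V ^ n : Submodule K L) ≤ C * (n + 1) ^ d := by
  classical
  let γ : MvPolynomial (Fin d) K →ₐ[K] L := R.val.comp g
  let P : ℕ → Submodule K L :=
    fun n => (MvPolynomial.restrictTotalDegree (Fin d) K n).map γ.toLinearMap
  have hPfin : ∀ n, FiniteDimensional K (P n) := fun n => inferInstance
  have hPmono : Monotone P := by
    intro a b hab
    apply Submodule.map_mono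
    intro p hp
    rw [MvPolynomial.mem_restrictTotalDegree] at hp ⊢
    exact hp.trans hab
  have hPmul : ∀ a b, P a * P b ≤ P (a + b) := by
    intro a b
    rw [Submodule.mul_le]
    rintro _ ⟨p, hp, rfl⟩ _ ⟨q, hq, rfl⟩
    refine ⟨p * q, ?_, by simp⟩
    simp only [SetLike.mem_coe] at hp hq ⊢
    rw [MvPolynomial.mem_restrictTotalDegree] at hp hq ⊢
    exact (MvPolynomial.totalDegree_mul _ _).trans (add_le_add hp hq)
  -- `H` is spanned by module generators of `R` over the polynomial ring, and `P n` is the image of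
  -- the polynomials of degree at most `n`: the proof bounds `V ^ n` by `P (D * n) * H`.
  obtain ⟨H, hHfin, hH1, hHR, hH⟩ : ∃ H : Submodule K L, FiniteDimensional K H ∧ (1 : L) ∈ H ∧
      H ≤ R.toSubmodule ∧ ∀ r : R, ∃ D, (r : L) ∈ P D * H := by
    algebraize [g.toRingHom]
    have hfin : Module.Finite (MvPolynomial (Fin d) K) R := hg
    obtain ⟨s, hs⟩ := hfin.fg_top
    refine ⟨Submodule.span K (insert 1 (s.image (fun r : R => (r : L)) : Finset L) : Set L),
      FiniteDimensional.span_of_finite K (by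
        exact (Finset.finite_toSet _).insert 1),
      Submodule.subset_span (Set.mem_insert _ _), ?_, ?_⟩
    · rw [Submodule.span_le]
      rintro z hz
      rcases hz with rfl | hz
      · exact R.one_mem
      · obtain ⟨r, -, rfl⟩ := Finset.mem_image.1 hz
        exact r.2
    · intro r
      have hr : r ∈ Submodule.span (MvPolynomial (Fin d) K) (s : Set R) := hs ▸ Submodule.mem_top
      induction hr using Submodule.span_induction with
      | mem x hx =>
        refine ⟨0, ?_⟩
        rw [← one_mul (x : L)]
        refine Submodule.mul_mem_mul ⟨1, ?_, by simp⟩ (Submodule.subset_span (Or.inr ?_))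
        · simp [MvPolynomial.mem_restrictTotalDegree]
        · exact Finset.mem_image_of_mem _ hx
      | zero => exact ⟨0, by simp⟩
      | add x y _ _ hx hy =>
        obtain ⟨a, ha⟩ := hx
        obtain ⟨b, hb⟩ := hy
        refine ⟨max a b, ?_⟩
        rw [Subalgebra.coe_add]
        exact Submodule.add_mem _ (mul_le_mul' (hPmono (le_max_left a b)) le_rfl ha)
          (mul_le_mul' (hPmono (le_max_right a b)) le_rfl hb)
      | smul p x _ hx =>
        obtain ⟨a, ha⟩ := hx
        refine ⟨p.totalDegree + a, ?_⟩
        have e : ((p • x : R) : L) = γ p * x := by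
          rw [Algebra.smul_def]; rfl
        rw [e]
        refine mul_le_mul' (hPmul _ _) le_rfl ?_
        rw [mul_assoc]
        exact Submodule.mul_mem_mul ⟨p, by
          simp [MvPolynomial.mem_restrictTotalDegree], rfl⟩ ha
  obtain ⟨D, hD⟩ : ∃ D, V * H ≤ P D * H := by
    have hfg : (V * H).FG := Submodule.FG.mul ((Submodule.fg_iff_finiteDimensional _).2 ‹_›)
      ((Submodule.fg_iff_finiteDimensional _).2 hHfin)
    have hVHR : V * H ≤ R.toSubmodule := by
      rw [Submodule.mul_le]
      intro a ha b hb
      exact R.mul_mem (hV ha) (hHR hb)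
    obtain ⟨s, hs⟩ := hfg
    have hsR : ∀ z ∈ s, ∃ D, z ∈ P D * H := by
      intro z hz
      have hz' : z ∈ R := hVHR (by rw [← hs]; exact Submodule.subset_span hz)
      exact hH ⟨z, hz'⟩
    choose! D hD using hsR
    refine ⟨s.sup D, ?_⟩
    rw [← hs, Submodule.span_le]
    intro z hz
    exact mul_le_mul' (hPmono (Finset.le_sup hz)) le_rfl (hD z hz)
  have hpow : ∀ n, V ^ n * H ≤ P (D * n) * H := by
    intro n
    induction n with
    | zero =>
      rw [pow_zero]
      refine mul_le_mul' ?_ le_rfl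
      rw [Submodule.one_le]
      exact ⟨1, by simp [MvPolynomial.mem_restrictTotalDegree], by simp⟩
    | succ n ih =>
      calc V ^ (n + 1) * H = V * (V ^ n * H) := by rw [pow_succ', mul_assoc]
        _ ≤ V * (P (D * n) * H) := mul_le_mul' le_rfl ih
        _ = P (D * n) * (V * H) := by rw [← mul_assoc, mul_comm V, mul_assoc]
        _ ≤ P (D * n) * (P D * H) := mul_le_mul' le_rfl hD
        _ = P (D * n) * P D * H := by rw [mul_assoc]
        _ ≤ P (D * n + D) * H := mul_le_mul' (hPmul _ _) le_rfl
        _ = P (D * (n + 1)) * H := by rw [mul_add, mul_one]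
  refine ⟨(D + 1) ^ d * Module.finrank K H, fun n => ?_⟩
  have hfinPH : FiniteDimensional K (P (D * n) * H : Submodule K L) :=
    (Submodule.fg_iff_finiteDimensional _).1
      (Submodule.FG.mul ((Submodule.fg_iff_finiteDimensional _).2 (hPfin _))
        ((Submodule.fg_iff_finiteDimensional _).2 hHfin))
  have h1 : V ^ n ≤ P (D * n) * H := by
    refine le_trans ?_ (hpow n)
    intro z hz
    rw [← mul_one z]
    exact Submodule.mul_mem_mul hz hH1
  calc Module.finrank K (V ^ n : Submodule K L)
      ≤ Module.finrank K (P (D * n) * H : Submodule K L) := Submodule.finrank_mono h1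
    _ ≤ Module.finrank K (P (D * n)) * Module.finrank K H :=
        Submodule.finrank_mul_le_mul_finrank _ _
    _ ≤ (D * n + 1) ^ d * Module.finrank K H := Nat.mul_le_mul_right _
        ((Submodule.finrank_map_le _ _).trans (finrank_restrictTotalDegree_le d _))
    _ ≤ ((D + 1) * (n + 1)) ^ d * Module.finrank K H :=
        Nat.mul_le_mul_right _ (Nat.pow_le_pow_left (by nlinarith) _)
    _ = (D + 1) ^ d * Module.finrank K H * (n + 1) ^ d := by rw [mul_pow]; ring

/-- The field generated by a finite-dimensional space `V` has a monomial frame whose rank bounds the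
order of growth of the powers of `V`. Both come from a Noether normalization of the algebra
generated by `V`. -/
theorem exists_growth_and_monomialFrame (V : Submodule K L) [FiniteDimensional K V] :
    ∃ d : ℕ, (∃ C : ℕ, ∀ n : ℕ, Module.finrank K (V ^ n : Submodule K L) ≤ C * (n + 1) ^ d) ∧
      ∃ f : ℕ, Nonempty (MonomialFrame K (IntermediateField.adjoin K (V : Set L)) d f) := by
  classical
  obtain ⟨s, hs⟩ := (Submodule.fg_iff_finiteDimensional V).2 ‹_›
  set R := Algebra.adjoin K (s : Set L) with hR
  have hVR : V ≤ R.toSubmodule := by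
    rw [← hs, Submodule.span_le]
    exact Algebra.subset_adjoin
  have hft : Algebra.FiniteType K R := R.fg_iff_finiteType.1 ⟨s, rfl⟩
  obtain ⟨d, g, hginj, hgfin⟩ := exists_finite_inj_algHom_of_fg K R
  refine ⟨d, exists_finrank_pow_le R V hVR g hgfin, ?_⟩
  set E := IntermediateField.adjoin K (V : Set L) with hE
  have hEs : E = IntermediateField.adjoin K (s : Set L) := by
    apply le_antisymm
    · rw [hE, IntermediateField.adjoin_le_iff]
      intro z hz
      exact IntermediateField.algebra_adjoin_le_adjoin K _ (hVR hz)
    · rw [IntermediateField.adjoin_le_iff]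
      intro z hz
      exact IntermediateField.subset_adjoin _ _ (by
        change z ∈ V
        rw [← hs]; exact Submodule.subset_span hz)
  have hRE : R ≤ E.toSubalgebra := by
    rw [hEs]; exact IntermediateField.algebra_adjoin_le_adjoin K _
  let ι : R →ₐ[K] E := Subalgebra.inclusion hRE
  have hι : Function.Injective ι := Subalgebra.inclusion_injective hRE
  let x : Fin d → E := fun i => ι (g (MvPolynomial.X i))
  have hxaeval : MvPolynomial.aeval x = ι.comp g := by
    ext i; simp [x]
  have hx : AlgebraicIndependent K x := by
    rw [algebraicIndependent_iff_injective_aeval, hxaeval]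
    exact hι.comp hginj
  set M := IntermediateField.adjoin K (Set.range x) with hM
  let h : MvPolynomial (Fin d) K →ₐ[K] M := MvPolynomial.aeval fun i =>
    (⟨x i, IntermediateField.subset_adjoin _ _ ⟨i, rfl⟩⟩ : M)
  have hh : ∀ p, algebraMap M E (h p) = ι (g p) := by
    intro p
    have : (IsScalarTower.toAlgHom K M E).comp h = ι.comp g := by
      ext i; simp [h, x]
    exact congrArg (fun φ => φ p) this
  let T : Set E := (Subtype.val : E → L) ⁻¹' (s : Set L)
  have hTfin : T.Finite := s.finite_toSet.preimage Subtype.val_injective.injOn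
  have hTint : ∀ z ∈ T, IsIntegral M z := by
    intro z hz
    have hzR : (z : L) ∈ R := Algebra.subset_adjoin hz
    obtain ⟨p, hp1, hp2⟩ := (RingHom.Finite.to_isIntegral (f := g.toRingHom) hgfin) ⟨z, hzR⟩
    refine ⟨p.map h.toRingHom, hp1.map _, ?_⟩
    rw [Polynomial.eval₂_map]
    have e1 : (algebraMap M E).comp h.toRingHom = (ι : R →+* E).comp g.toRingHom :=
      RingHom.ext hh
    have e2 : z = (ι : R →+* E) ⟨z, hzR⟩ := rfl
    rw [e1, e2, ← Polynomial.hom_eval₂, hp2, map_zero]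
  have htop : IntermediateField.adjoin M T = ⊤ := by
    have h1 : IntermediateField.adjoin K T = ⊤ := by
      apply IntermediateField.lift_injective E
      rw [IntermediateField.lift_adjoin, IntermediateField.lift_top]
      refine Eq.trans ?_ hEs.symm
      congr 1
      ext z
      constructor
      · rintro ⟨w, hw, rfl⟩
        exact hw
      · intro hz
        exact ⟨⟨z, hRE (Algebra.subset_adjoin hz)⟩, hz, rfl⟩
    rw [eq_top_iff]
    intro z _
    have hz : z ∈ IntermediateField.adjoin K T := by rw [h1]; trivial
    have hle : IntermediateField.adjoin K T ≤
        IntermediateField.restrictScalars K (IntermediateField.adjoin M T) := by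
      rw [IntermediateField.adjoin_le_iff]
      exact IntermediateField.subset_adjoin M T
    exact hle hz
  have : Finite T := hTfin
  have hfd := IntermediateField.finiteDimensional_adjoin hTint
  rw [htop] at hfd
  have : FiniteDimensional M E :=
    Module.Finite.equiv (IntermediateField.topEquiv (F := M) (E := E)).toLinearEquiv
  exact exists_monomialFrame hx

end Growth

/-! ### Approximable algebras -/

section Graded

variable {K : Type*} [Field K] {B : Type*} [CommRing B] [Algebra K B] {ℬ : ℕ → Submodule K B}

theorem pow_graded_le [GradedAlgebra ℬ] (p n : ℕ) : (ℬ p) ^ n ≤ ℬ (n * p) := by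
  induction n with
  | zero =>
    rw [pow_zero, zero_mul, Submodule.one_le]
    exact SetLike.GradedOne.one_mem
  | succ n ih =>
    rw [pow_succ, Submodule.mul_le]
    intro a ha b hb
    rw [Nat.succ_mul]
    exact SetLike.GradedMul.mul_mem (ih ha) hb

variable [IsDomain B]

theorem IsApproximable.exists_ne_zero [GradedAlgebra ℬ] (hB : IsApproximable ℬ) :
    ∃ N : ℕ, ∀ n, N ≤ n → ∃ b ∈ ℬ n, b ≠ 0 := by
  obtain ⟨N, hN⟩ := eventually_atTop.1 hB.eventually_ne_bot
  exact ⟨N, fun n hn => (Submodule.ne_bot_iff _).1 (hN n hn)⟩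

/-- Multiplication by a nonzero element of `B_j` is injective. -/
theorem IsApproximable.finrank_le_finrank_add [GradedAlgebra ℬ] (hB : IsApproximable ℬ) (n j : ℕ)
    (hj : ∃ b ∈ ℬ j, b ≠ 0) : Module.finrank K (ℬ n) ≤ Module.finrank K (ℬ (n + j)) := by
  obtain ⟨b, hb, hb0⟩ := hj
  have := hB.finiteDimensional (n + j)
  let g : ℬ n →ₗ[K] ℬ (n + j) := ((LinearMap.mulRight K b).comp (ℬ n).subtype).codRestrict _
    fun a => SetLike.GradedMul.mul_mem a.2 hb
  refine LinearMap.finrank_le_finrank_of_injective (f := g) ?_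
  rw [injective_iff_map_eq_zero]
  intro a ha
  have h : (a : B) * b = 0 := congrArg Subtype.val ha
  exact Subtype.ext ((mul_eq_zero.1 h).resolve_right hb0)

/-- Approximability with `ε = 1 / 4`: for suitable large `p`, the products of `n` elements of `B_p`
span at least `3 / 4` of `B_{np}`. Any proportion above `1 / 2` would do. -/
theorem IsApproximable.exists_finrank_le [GradedAlgebra ℬ] (hB : IsApproximable ℬ) (N : ℕ) :
    ∃ p n₁ : ℕ, N ≤ p ∧ 1 ≤ p ∧ ∀ n, n₁ ≤ n →
      3 * Module.finrank K (ℬ (n * p)) ≤ 4 * Module.finrank K ((ℬ p) ^ n : Submodule K B) := by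
  obtain ⟨p₀, hp₀, h⟩ := hB.approx (1 / 4) (by norm_num) (by norm_num)
  refine ⟨max p₀ N, ?_⟩
  have h1 := h (max p₀ N) (le_max_left _ _)
  have h2 := eventually_lt_of_lt_liminf h1 (by
    refine ⟨0, ?_⟩
    rw [eventually_map]
    exact Eventually.of_forall fun n => by positivity)
  obtain ⟨n₁, hn₁⟩ := eventually_atTop.1 h2
  refine ⟨n₁, le_max_right _ _, hp₀.trans (le_max_left _ _), fun n hn => ?_⟩
  have h3 := hn₁ n hn
  rcases Nat.eq_zero_or_pos (Module.finrank K (ℬ (n * max p₀ N))) with h0 | h0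
  · rw [h0]; simp
  · have h0' : (0 : ℝ) < Module.finrank K (ℬ (n * max p₀ N)) := by exact_mod_cast h0
    rw [lt_div_iff₀ h0'] at h3
    have h4 : (3 : ℝ) * Module.finrank K (ℬ (n * max p₀ N)) ≤
        4 * Module.finrank K ((ℬ (max p₀ N)) ^ n : Submodule K B) := by linarith
    exact_mod_cast h4

/-- The exponential `(3 / 2) ^ i` outgrows every polynomial in `i`. -/
theorem not_forall_pow_le (C a D d : ℕ) :
    ¬ ∀ i : ℕ, (3 : ℝ) ^ i ≤ 2 ^ i * (C * (a + i * D + 1) ^ d) := by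
  intro h
  have hlim := (tendsto_pow_const_div_const_pow_of_one_lt d
    (show (1 : ℝ) < 3 / 2 by norm_num)).const_mul ((C : ℝ) * (a + D + 1) ^ d)
  rw [mul_zero] at hlim
  obtain ⟨i, hi, hi1⟩ :=
    ((hlim.eventually (gt_mem_nhds one_pos)).and (eventually_ge_atTop 1)).exists
  have h3 : (0 : ℝ) < (3 / 2) ^ i := by positivity
  rw [← mul_div_assoc, div_lt_one h3, div_pow, lt_div_iff₀ (by positivity)] at hi
  have h4 : ((a : ℝ) + i * D + 1) ^ d ≤ (a + D + 1) ^ d * i ^ d := by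
    rw [← mul_pow]
    refine pow_le_pow_left₀ (by positivity) ?_ _
    have hi1' : (1 : ℝ) ≤ i := by exact_mod_cast hi1
    nlinarith [(Nat.cast_nonneg a : (0 : ℝ) ≤ a), (Nat.cast_nonneg D : (0 : ℝ) ≤ D)]
  have h5 := h i
  have h6 : (2 : ℝ) ^ i * (C * (a + i * D + 1) ^ d) ≤ C * (a + D + 1) ^ d * i ^ d * 2 ^ i := by
    calc (2 : ℝ) ^ i * (C * (a + i * D + 1) ^ d) ≤ 2 ^ i * (C * ((a + D + 1) ^ d * i ^ d)) := by
          gcongr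
      _ = _ := by ring
  linarith

variable (ℬ) in
/-- The field of homogeneous fractions of degree zero. -/
def degZeroField [GradedAlgebra ℬ] : IntermediateField K (FractionRing B) where
  carrier := {z | ∃ (n : ℕ) (a b : B), a ∈ ℬ n ∧ b ∈ ℬ n ∧ b ≠ 0 ∧
    z = algebraMap B (FractionRing B) a / algebraMap B (FractionRing B) b}
  mul_mem' := by
    rintro _ _ ⟨n, a, b, ha, hb, hb0, rfl⟩ ⟨n', a', b', ha', hb', hb0', rfl⟩
    refine ⟨n + n', a * a', b * b', SetLike.GradedMul.mul_mem ha ha',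
      SetLike.GradedMul.mul_mem hb hb', mul_ne_zero hb0 hb0', ?_⟩
    rw [map_mul, map_mul, div_mul_div_comm]
  add_mem' := by
    rintro _ _ ⟨n, a, b, ha, hb, hb0, rfl⟩ ⟨n', a', b', ha', hb', hb0', rfl⟩
    refine ⟨n + n', a * b' + b * a', b * b', Submodule.add_mem _ (SetLike.GradedMul.mul_mem ha hb')
      (SetLike.GradedMul.mul_mem hb ha'),
      SetLike.GradedMul.mul_mem hb hb', mul_ne_zero hb0 hb0', ?_⟩
    rw [div_add_div _ _ (by simpa using hb0) (by simpa using hb0')]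
    simp only [map_mul, map_add]
  algebraMap_mem' := by
    intro c
    refine ⟨0, algebraMap K B c, 1, ?_, SetLike.GradedOne.one_mem, one_ne_zero, ?_⟩
    · rw [Algebra.algebraMap_eq_smul_one]
      exact Submodule.smul_mem _ _ SetLike.GradedOne.one_mem
    · rw [map_one, div_one, ← IsScalarTower.algebraMap_apply]
  inv_mem' := by
    rintro _ ⟨n, a, b, ha, hb, hb0, rfl⟩
    by_cases ha0 : a = 0
    · exact ⟨n, 0, b, Submodule.zero_mem _, hb, hb0, by simp [ha0]⟩
    · exact ⟨n, b, a, hb, ha, ha0, by rw [inv_div]⟩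

/-- Finitely many homogeneous fractions of degree zero have a common denominator, of arbitrarily
large degree. -/
theorem exists_common_denominator [GradedAlgebra ℬ] (hB : IsApproximable ℬ) (M₀ : ℕ)
    (s : Finset (FractionRing B)) (hs : ∀ z ∈ s, z ∈ degZeroField ℬ) :
    ∃ m, M₀ ≤ m ∧ ∃ b ∈ ℬ m, b ≠ 0 ∧ ∀ z ∈ s, ∃ a ∈ ℬ m,
      z = algebraMap B (FractionRing B) a / algebraMap B (FractionRing B) b := by
  classical
  induction s using Finset.induction_on with
  | empty =>
    obtain ⟨N, hN⟩ := hB.exists_ne_zero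
    obtain ⟨b, hb, hb0⟩ := hN (max N M₀) (le_max_left _ _)
    exact ⟨_, le_max_right _ _, b, hb, hb0, by simp⟩
  | insert w s _ ih =>
    obtain ⟨m, hm, b, hb, hb0, h⟩ := ih fun z hz => hs z (Finset.mem_insert_of_mem hz)
    obtain ⟨n, a', b', ha', hb', hb0', rfl⟩ := hs w (Finset.mem_insert_self _ _)
    refine ⟨m + n, by omega, b * b', SetLike.GradedMul.mul_mem hb hb', mul_ne_zero hb0 hb0', ?_⟩
    have hb1 : algebraMap B (FractionRing B) b ≠ 0 := by simpa using hb0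
    have hb1' : algebraMap B (FractionRing B) b' ≠ 0 := by simpa using hb0'
    intro z hz
    rcases Finset.mem_insert.1 hz with rfl | hz
    · refine ⟨b * a', SetLike.GradedMul.mul_mem hb ha', ?_⟩
      rw [map_mul, map_mul, mul_div_mul_left _ _ hb1]
    · obtain ⟨a, ha, rfl⟩ := h z hz
      refine ⟨a * b', SetLike.GradedMul.mul_mem ha hb', ?_⟩
      rw [map_mul, map_mul, mul_div_mul_right _ _ hb1']

/-- The field of homogeneous fractions of degree zero of an approximable algebra is generated by
the fractions `a / e` with `a ∈ B_p`. Otherwise a fraction `z = a / b` outside of the subfield they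
generate would make the sums `a A_n + b A_n` direct, where `A_n = (B_p) ^ n`; since `A_n` makes up
at least `3 / 4` of `B_{np}`, the rank of `A_n` would grow exponentially. -/
theorem IsApproximable.degZeroField_le [GradedAlgebra ℬ] (hB : IsApproximable ℬ)
    {p n₁ C d : ℕ} (hp : 1 ≤ p) {e : B} (he : e ∈ ℬ p) (he0 : e ≠ 0)
    (h34 : ∀ n, n₁ ≤ n →
      3 * Module.finrank K (ℬ (n * p)) ≤ 4 * Module.finrank K ((ℬ p) ^ n : Submodule K B))
    (hC : ∀ n, Module.finrank K ((ℬ p) ^ n : Submodule K B) ≤ C * (n + 1) ^ d)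
    (E : IntermediateField K (FractionRing B))
    (hE : ∀ n, ∀ u ∈ (ℬ p) ^ n,
      algebraMap B (FractionRing B) u / algebraMap B (FractionRing B) e ^ n ∈ E) :
    degZeroField ℬ ≤ E := by
  rintro _ ⟨D, a, b, ha, hb, hb0, rfl⟩
  by_contra hz
  set j := algebraMap B (FractionRing B) with hj
  have hj0 : ∀ {x : B}, x ≠ 0 → j x ≠ 0 := fun hx => by simpa [hj] using hx
  -- Rewrite the fraction with numerator and denominator of degree a multiple of `p`.
  have ha' : a * b ^ (p - 1) ∈ ℬ (D * p) := by
    have h1 : a * b ^ (p - 1) ∈ ℬ (D + (p - 1) * D) :=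
      SetLike.GradedMul.mul_mem ha (SetLike.pow_mem_graded _ hb)
    have e1 : D + (p - 1) * D = D * p := by
      obtain ⟨q, rfl⟩ := Nat.exists_eq_add_of_le hp
      simp; ring
    rwa [e1] at h1
  have hb' : b ^ p ∈ ℬ (D * p) := by
    rw [mul_comm D]; exact SetLike.pow_mem_graded _ hb
  set a' := a * b ^ (p - 1) with ha'_def
  set b' := b ^ p with hb'_def
  have hb0' : b' ≠ 0 := pow_ne_zero _ hb0
  have hzE : j a' / j b' ∉ E := by
    have e1 : j a' / j b' = j a / j b := by
      have e2 : b' = b * b ^ (p - 1) := by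
        rw [hb'_def, ← pow_succ', Nat.sub_add_cancel hp]
      rw [ha'_def, e2, map_mul, map_mul, mul_div_mul_right _ _ (hj0 (pow_ne_zero _ hb0))]
    rwa [e1]
  -- `a' A_n + b' A_n` is a direct sum inside `B_{(n + D) p}`.
  have hstep : ∀ n, 2 * Module.finrank K ((ℬ p) ^ n : Submodule K B) ≤
      Module.finrank K (ℬ ((n + D) * p)) := by
    intro n
    have hfd := hB.finiteDimensional ((n + D) * p)
    have hfd' : FiniteDimensional K ((ℬ p) ^ n : Submodule K B) := by
      have := hB.finiteDimensional (n * p)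
      exact Submodule.finiteDimensional_of_le (pow_graded_le p n)
    let A := ((ℬ p) ^ n : Submodule K B)
    let g : (A × A) →ₗ[K] ℬ ((n + D) * p) :=
      (((LinearMap.mulRight K a').comp A.subtype).coprod
        ((LinearMap.mulRight K b').comp A.subtype)).codRestrict _ (by
          rintro ⟨u, w⟩
          have e1 : (n + D) * p = n * p + D * p := by ring
          rw [e1]
          exact Submodule.add_mem _ (SetLike.GradedMul.mul_mem (pow_graded_le p n u.2) ha')
            (SetLike.GradedMul.mul_mem (pow_graded_le p n w.2) hb'))
    have hg : Function.Injective g := by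
      rw [injective_iff_map_eq_zero]
      rintro ⟨u, w⟩ huw
      have h : (u : B) * a' + w * b' = 0 := congrArg Subtype.val huw
      have hu : (u : B) = 0 := by
        by_contra hu
        apply hzE
        have h1 : j u / j e ^ n ∈ E := hE n u u.2
        have h2 : j w / j e ^ n ∈ E := hE n w w.2
        have h3 : j a' / j b' = -((j w / j e ^ n) / (j u / j e ^ n)) := by
          rw [div_div_div_cancel_right₀ (pow_ne_zero _ (hj0 he0)), ← neg_div,
            div_eq_div_iff (hj0 hb0') (hj0 hu), ← map_neg, ← map_mul, ← map_mul]
          congr 1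
          linear_combination h
        rw [h3]
        exact E.neg_mem (E.div_mem h2 h1)
      have hw : (w : B) = 0 := by
        rw [hu, zero_mul, zero_add] at h
        exact (mul_eq_zero.1 h).resolve_right hb0'
      exact Prod.ext (Subtype.ext hu) (Subtype.ext hw)
    have := LinearMap.finrank_le_finrank_of_injective hg
    rw [Module.finrank_prod] at this
    rw [two_mul]
    exact this
  have hstep' : ∀ n, n₁ ≤ n → 3 * Module.finrank K ((ℬ p) ^ n : Submodule K B) ≤
      2 * Module.finrank K ((ℬ p) ^ (n + D) : Submodule K B) := by
    intro n hn
    have h1 := hstep n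
    have h2 := h34 (n + D) (by omega)
    omega
  have hiter : ∀ i : ℕ, 3 ^ i * Module.finrank K ((ℬ p) ^ n₁ : Submodule K B) ≤
      2 ^ i * Module.finrank K ((ℬ p) ^ (n₁ + i * D) : Submodule K B) := by
    intro i
    induction i with
    | zero =>
      have e1 : n₁ + 0 * D = n₁ := by simp
      rw [e1]
      simp
    | succ i ih =>
      have h1 := hstep' (n₁ + i * D) (by omega)
      have e1 : n₁ + i * D + D = n₁ + (i + 1) * D := by ring
      rw [e1] at h1
      calc 3 ^ (i + 1) * Module.finrank K ((ℬ p) ^ n₁ : Submodule K B)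
          = 3 * (3 ^ i * Module.finrank K ((ℬ p) ^ n₁ : Submodule K B)) := by ring
        _ ≤ 3 * (2 ^ i * Module.finrank K ((ℬ p) ^ (n₁ + i * D) : Submodule K B)) := by gcongr
        _ = 2 ^ i * (3 * Module.finrank K ((ℬ p) ^ (n₁ + i * D) : Submodule K B)) := by ring
        _ ≤ 2 ^ i * (2 * Module.finrank K ((ℬ p) ^ (n₁ + (i + 1) * D) : Submodule K B)) := by
          gcongr
        _ = _ := by ring
  have hpos : 1 ≤ Module.finrank K ((ℬ p) ^ n₁ : Submodule K B) := by
    have hfd' : FiniteDimensional K ((ℬ p) ^ n₁ : Submodule K B) := by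
      have := hB.finiteDimensional (n₁ * p)
      exact Submodule.finiteDimensional_of_le (pow_graded_le p n₁)
    refine Submodule.one_le_finrank_iff.2 ?_
    rw [Submodule.ne_bot_iff]
    exact ⟨e ^ n₁, Submodule.pow_mem_pow _ he _, pow_ne_zero _ he0⟩
  refine not_forall_pow_le C n₁ D d fun i => ?_
  have h1 := hiter i
  have h2 := hC (n₁ + i * D)
  have h3 : 3 ^ i ≤ 2 ^ i * (C * (n₁ + i * D + 1) ^ d) :=
    calc 3 ^ i = 3 ^ i * 1 := by ring
      _ ≤ 3 ^ i * Module.finrank K ((ℬ p) ^ n₁ : Submodule K B) := by gcongr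
      _ ≤ _ := h1
      _ ≤ _ := by gcongr
  exact_mod_cast h3

/-- Let a monomial frame of rank `d` on the field of homogeneous fractions of degree zero be given.
For a suitable `m` and every subspace `W` of some `B_q`, the products `w ^ k * u` with `w ∈ W` and
`u ∈ (B_m) ^ (d * k + 1)` span a space of dimension at least `k ^ d * dim W`. Here `B_m` contains
common multiples of the numerators and denominators of the frame, so that `(B_m) ^ (d * k + 1)`
contains, up to a common denominator, all monomials with exponents in `[0, k)^d`. -/
theorem MonomialFrame.exists_pow_mul_finrank_le [GradedAlgebra ℬ] (hB : IsApproximable ℬ)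
    {E : IntermediateField K (FractionRing B)} (hE1 : E ≤ degZeroField ℬ)
    (hE2 : degZeroField ℬ ≤ E) {d f : ℕ} (Φ : MonomialFrame K E d f) (M₀ : ℕ) :
    ∃ m, M₀ ≤ m ∧ ∀ (q : ℕ) (W : Submodule K B), W ≤ ℬ q → ∀ k : ℕ, 1 ≤ k →
      ∀ Z : Submodule K B, FiniteDimensional K Z →
      (∀ w ∈ W, ∀ u ∈ (ℬ m) ^ (d * k + 1), w ^ k * u ∈ Z) →
      k ^ d * Module.finrank K W ≤ Module.finrank K Z := by
  classical
  obtain ⟨m, hm, b, hb, hb0, hcd⟩ := exists_common_denominator hB M₀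
    ((Finset.univ.image fun i => ((Φ.x i : E) : FractionRing B)) ∪
      Finset.univ.image fun i => ((Φ.y i : E) : FractionRing B)) (by
        intro z hz
        rcases Finset.mem_union.1 hz with hz | hz
        · obtain ⟨i, -, rfl⟩ := Finset.mem_image.1 hz
          exact hE1 (Φ.x i : E).2
        · obtain ⟨i, -, rfl⟩ := Finset.mem_image.1 hz
          exact hE1 (Φ.y i : E).2)
  refine ⟨m, hm, ?_⟩
  choose a ha hxa using fun i => hcd _ (Finset.mem_union_left _
    (Finset.mem_image_of_mem (fun i => ((Φ.x i : E) : FractionRing B)) (Finset.mem_univ i)))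
  choose c hc hyc using fun i => hcd _ (Finset.mem_union_right _
    (Finset.mem_image_of_mem (fun i => ((Φ.y i : E) : FractionRing B)) (Finset.mem_univ i)))
  intro q W hWq k hk Z hZ hWZ
  set j := algebraMap B (FractionRing B) with hj
  have hj0 : ∀ {x : B}, x ≠ 0 → j x ≠ 0 := fun hx => by simpa [hj] using hx
  have hjinj : Function.Injective j := IsFractionRing.injective B (FractionRing B)
  by_cases hWbot : W = ⊥
  · subst hWbot; simp
  -- Dividing by `β` maps `W` into the field of the frame, and multiplying by the denominator `κ`
  -- maps the independent family of the frame into the space of the products `w ^ k * u`.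
  obtain ⟨β, hβW, hβ0⟩ := (Submodule.ne_bot_iff _).1 hWbot
  have hβ := hWq hβW
  have hWfd : FiniteDimensional K W := by
    have := hB.finiteDimensional q
    exact Submodule.finiteDimensional_of_le hWq
  let θL : W →ₗ[K] FractionRing B := (LinearMap.mulRight K (j β)⁻¹).comp
    ((IsScalarTower.toAlgHom K B (FractionRing B)).toLinearMap.comp W.subtype)
  have hθL : ∀ w : W, θL w = j w / j β := fun w => by
    rw [div_eq_mul_inv]; rfl
  let θ : W →ₗ[K] E := θL.codRestrict (Subalgebra.toSubmodule E.toSubalgebra) fun w => by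
    rw [hθL]
    exact hE2 ⟨q, w, β, hWq w.2, hβ, hβ0, rfl⟩
  have hθ : ∀ w : W, ((θ w : E) : FractionRing B) = j w / j β := hθL
  have hθinj : Function.Injective θ := by
    rw [injective_iff_map_eq_zero]
    intro w hw
    have h1 := hθ w
    rw [hw] at h1
    have h2 : j w = 0 := by
      rcases div_eq_zero_iff.1 h1.symm with h | h
      · exact h
      · exact absurd h (hj0 hβ0)
    exact Subtype.ext (hjinj (by rw [h2]; simp))
  obtain ⟨t, ht1, ht2, ht3⟩ := Φ.exists_finset_values (LinearMap.range θ)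
  rw [LinearMap.finrank_range_of_inj hθinj] at ht3
  have hli := Φ.linearIndependent_pow_mul_mon t (fun z hz => (ht1 z hz).2) ht2 k hk
  have hlift : ∀ z : t, ∃ w : W, θ w = z := fun z => (ht1 z z.2).1
  choose ω hω using hlift
  -- The numerators of the elements of the independent family over the denominator `β ^ k * b ^ _`.
  let G : (t × (Fin d → Fin k)) × Fin f → B := fun p =>
    (ω p.1.1 : B) ^ k * ((∏ i, (a i ^ (p.1.2 i : ℕ) * b ^ (k - (p.1.2 i : ℕ)))) * c p.2)
  have hGZ : ∀ p, G p ∈ Z := by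
    intro p
    refine hWZ _ (ω p.1.1).2 _ ?_
    rw [pow_succ]
    refine Submodule.mul_mem_mul ?_ (hc _)
    have h1 : ∀ s : Finset (Fin d), (∏ i ∈ s, (a i ^ (p.1.2 i : ℕ) * b ^ (k - (p.1.2 i : ℕ)))) ∈
        (ℬ m) ^ (s.card * k) := by
      intro s
      induction s using Finset.cons_induction with
      | empty => simp
      | cons i s hi ih =>
        rw [Finset.prod_cons, Finset.card_cons, Nat.succ_mul, add_comm, pow_add]
        refine Submodule.mul_mem_mul ?_ ih
        have h2 : (p.1.2 i : ℕ) + (k - (p.1.2 i : ℕ)) = k := Nat.add_sub_cancel' (p.1.2 i).2.le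
        have h3 : a i ^ (p.1.2 i : ℕ) * b ^ (k - (p.1.2 i : ℕ)) ∈
            (ℬ m) ^ ((p.1.2 i : ℕ) + (k - (p.1.2 i : ℕ))) := by
          rw [pow_add]
          exact Submodule.mul_mem_mul (Submodule.pow_mem_pow _ (ha i) _)
            (Submodule.pow_mem_pow _ hb _)
        rwa [h2] at h3
    have := h1 Finset.univ
    rwa [Finset.card_univ, Fintype.card_fin] at this
  set κ : FractionRing B := j β ^ k * j b ^ (d * k + 1) with hκ
  have hκ0 : κ ≠ 0 := mul_ne_zero (pow_ne_zero _ (hj0 hβ0)) (pow_ne_zero _ (hj0 hb0))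
  have hGκ : ∀ p : (t × (Fin d → Fin k)) × Fin f, j (G p) = κ *
      (((p.1.1 : E) ^ k * Φ.mon (fun i => ((p.1.2 i : ℕ) : ℤ)) * Φ.y p.2 : E) :
        FractionRing B) := by
    intro p
    have e1 : (((p.1.1 : t) : E) : FractionRing B) * j β = j (ω p.1.1 : B) := by
      rw [← hω, hθ, div_mul_cancel₀ _ (hj0 hβ0)]
    have e2 : (Φ.y p.2 : FractionRing B) * j b = j (c p.2) := by
      rw [hyc, div_mul_cancel₀ _ (hj0 hb0)]
    have e3 : ((Φ.mon (fun i => ((p.1.2 i : ℕ) : ℤ)) : E) : FractionRing B) * j b ^ (d * k) =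
        j (∏ i, (a i ^ (p.1.2 i : ℕ) * b ^ (k - (p.1.2 i : ℕ)))) := by
      have e4 : ((Φ.mon (fun i => ((p.1.2 i : ℕ) : ℤ)) : E) : FractionRing B) =
          ∏ i, ((Φ.x i : E) : FractionRing B) ^ (p.1.2 i : ℕ) := by
        have : (Φ.mon (fun i => ((p.1.2 i : ℕ) : ℤ)) : E) = ∏ i, (Φ.x i : E) ^ (p.1.2 i : ℕ) := by
          simp [MonomialFrame.mon]
        rw [this]
        simp
      have e5 : j b ^ (d * k) = ∏ _i : Fin d, j b ^ k := by
        rw [Finset.prod_const, Finset.card_univ, Fintype.card_fin, ← pow_mul, mul_comm]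
      rw [e4, e5, ← Finset.prod_mul_distrib, map_prod]
      refine Finset.prod_congr rfl fun i _ => ?_
      rw [hxa, map_mul, map_pow, map_pow, div_pow, div_mul_eq_mul_div,
        div_eq_iff (pow_ne_zero _ (hj0 hb0)), mul_assoc, ← pow_add,
        Nat.sub_add_cancel (p.1.2 i).2.le]
    simp only [G, map_mul, map_pow]
    rw [← e1, ← e2, ← e3, hκ]
    push_cast
    ring
  have hliL := (hli.map' E.val.toLinearMap (LinearMap.ker_eq_bot.2 E.val.injective)).map'
    (LinearMap.mulLeft K κ) (LinearMap.ker_eq_bot.2 (mul_right_injective₀ hκ0))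
  have hliB : LinearIndependent K G := by
    apply LinearIndependent.of_comp (IsScalarTower.toAlgHom K B (FractionRing B)).toLinearMap
    have hcomp : (IsScalarTower.toAlgHom K B (FractionRing B)).toLinearMap ∘ G =
        LinearMap.mulLeft K κ ∘ E.val.toLinearMap ∘
          fun p : (t × (Fin d → Fin k)) × Fin f =>
            (p.1.1 : E) ^ k * Φ.mon (fun i => ((p.1.2 i : ℕ) : ℤ)) * Φ.y p.2 :=
      funext hGκ
    rw [hcomp]
    exact hliL
  have hliZ : LinearIndependent K (fun p => (⟨G p, hGZ p⟩ : Z)) :=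
    LinearIndependent.of_comp Z.subtype hliB
  have hcard := hliZ.fintype_card_le_finrank
  simp only [Fintype.card_prod, Fintype.card_coe, Fintype.card_fun, Fintype.card_fin] at hcard
  calc k ^ d * Module.finrank K W ≤ k ^ d * (f * t.card) := Nat.mul_le_mul_left _ ht3
    _ = t.card * k ^ d * f := by ring
    _ ≤ _ := hcard

/-- The ranks of an approximable algebra grow at most like `n ^ d`, while passing to `k`-th powers
multiplies dimensions by at least `k ^ d`, with the same `d`. -/
theorem IsApproximable.exists_growth [GradedAlgebra ℬ] (hB : IsApproximable ℬ) :
    ∃ d : ℕ, (∃ C : ℕ, ∀ n, 1 ≤ n → Module.finrank K (ℬ n) ≤ C * n ^ d) ∧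
      ∀ M₀ : ℕ, ∃ m, M₀ ≤ m ∧ ∀ (q : ℕ) (W : Submodule K B), W ≤ ℬ q → ∀ k : ℕ, 1 ≤ k →
        ∀ Z : Submodule K B, FiniteDimensional K Z →
        (∀ w ∈ W, ∀ u ∈ (ℬ m) ^ (d * k + 1), w ^ k * u ∈ Z) →
        k ^ d * Module.finrank K W ≤ Module.finrank K Z := by
  obtain ⟨N, hN⟩ := hB.exists_ne_zero
  obtain ⟨p, n₁, hpN, hp, h34⟩ := hB.exists_finrank_le N
  obtain ⟨e, he, he0⟩ := hN p hpN
  have hpfd := hB.finiteDimensional p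
  set j := algebraMap B (FractionRing B) with hj
  have hj0 : ∀ {x : B}, x ≠ 0 → j x ≠ 0 := fun hx => by simpa [hj] using hx
  let J := (IsScalarTower.toAlgHom K B (FractionRing B))
  have hJinj : Function.Injective J := IsFractionRing.injective B (FractionRing B)
  -- `V` consists of the fractions `a / e` with `a ∈ B_p`.
  set V : Submodule K (FractionRing B) :=
    (ℬ p).map J.toLinearMap * Submodule.span K {(j e)⁻¹} with hV
  have hVfd : FiniteDimensional K V := (Submodule.fg_iff_finiteDimensional _).1
    (Submodule.FG.mul (((Submodule.fg_iff_finiteDimensional _).2 hpfd).map _)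
      (Submodule.fg_span_singleton _))
  have hVpow : ∀ n, V ^ n = ((ℬ p) ^ n).map J.toLinearMap * Submodule.span K {(j e ^ n)⁻¹} := by
    intro n
    rw [hV, mul_pow, Submodule.map_pow, Submodule.span_pow, Set.singleton_pow, inv_pow]
  obtain ⟨d, ⟨C, hC⟩, f, ⟨Φ⟩⟩ := exists_growth_and_monomialFrame V
  have hCA : ∀ n, Module.finrank K ((ℬ p) ^ n : Submodule K B) ≤ C * (n + 1) ^ d := by
    intro n
    refine le_trans ?_ (hC n)
    have hfd : FiniteDimensional K (V ^ n : Submodule K (FractionRing B)) :=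
      (Submodule.fg_iff_finiteDimensional _).1
        (Submodule.FG.pow ((Submodule.fg_iff_finiteDimensional _).2 hVfd) n)
    have hfd' : FiniteDimensional K
        (V ^ n * Submodule.span K {j e ^ n} : Submodule K (FractionRing B)) :=
      (Submodule.fg_iff_finiteDimensional _).1
        (Submodule.FG.mul ((Submodule.fg_iff_finiteDimensional _).2 hfd)
          (Submodule.fg_span_singleton _))
    have h1 : ((ℬ p) ^ n).map J.toLinearMap = V ^ n * Submodule.span K {j e ^ n} := by
      rw [hVpow, mul_assoc, Submodule.span_mul_span, Set.singleton_mul_singleton,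
        inv_mul_cancel₀ (pow_ne_zero _ (hj0 he0)), ← Submodule.one_eq_span, mul_one]
    calc Module.finrank K ((ℬ p) ^ n : Submodule K B)
        = Module.finrank K (((ℬ p) ^ n).map J.toLinearMap) :=
          (Submodule.equivMapOfInjective J.toLinearMap hJinj _).finrank_eq
      _ = Module.finrank K (V ^ n * Submodule.span K {j e ^ n} :
            Submodule K (FractionRing B)) := by rw [h1]
      _ ≤ Module.finrank K (V ^ n : Submodule K (FractionRing B)) *
          Module.finrank K (Submodule.span K {j e ^ n}) :=
        Submodule.finrank_mul_le_mul_finrank _ _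
      _ = Module.finrank K (V ^ n : Submodule K (FractionRing B)) := by
        rw [finrank_span_singleton (pow_ne_zero _ (hj0 he0)), mul_one]
  set E := IntermediateField.adjoin K (V : Set (FractionRing B)) with hE
  have hVE : V ≤ Subalgebra.toSubmodule E.toSubalgebra := IntermediateField.subset_adjoin K _
  have hpowE : ∀ n, V ^ n ≤ Subalgebra.toSubmodule E.toSubalgebra := by
    intro n
    induction n with
    | zero =>
      rw [pow_zero, Submodule.one_le]
      exact E.one_mem
    | succ n ih =>
      rw [pow_succ, Submodule.mul_le]
      intro x hx y hy
      exact E.mul_mem (ih hx) (hVE hy)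
  have hE2 : degZeroField ℬ ≤ E := hB.degZeroField_le hp he he0 h34 hCA E (by
    intro n u hu
    apply hpowE n
    rw [hVpow, div_eq_mul_inv]
    exact Submodule.mul_mem_mul ⟨u, hu, rfl⟩ (Submodule.mem_span_singleton_self _))
  have hE1 : E ≤ degZeroField ℬ := by
    rw [hE, IntermediateField.adjoin_le_iff]
    have : V ≤ Subalgebra.toSubmodule (degZeroField ℬ).toSubalgebra := by
      rw [hV, Submodule.mul_le]
      rintro _ ⟨a, ha, rfl⟩ w hw
      obtain ⟨c, rfl⟩ := Submodule.mem_span_singleton.1 hw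
      rw [mul_smul_comm]
      exact Submodule.smul_mem _ _ ⟨p, a, e, ha, he, he0, (div_eq_mul_inv _ _).symm⟩
    exact this
  refine ⟨d, ⟨2 * C * (N + n₁ + 3) ^ d, fun n hn => ?_⟩,
    fun M₀ => Φ.exists_pow_mul_finrank_le hB hE1 hE2 M₀⟩
  -- `k * p` is the degree of a piece that is comparable with `B_n` and at least as large.
  set k := n / p + N + n₁ + 1 with hk
  have hkp : n + N ≤ k * p := by
    have h1 := Nat.div_add_mod n p
    have h2 := Nat.mod_lt n hp
    have h3 : k * p = p * (n / p) + N * p + n₁ * p + p := by rw [hk]; ring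
    have h4 : N ≤ N * p := Nat.le_mul_of_pos_right _ hp
    rw [h3]
    omega
  have hkn : k + 1 ≤ (N + n₁ + 3) * n := by
    have h1 : n / p ≤ n := Nat.div_le_self _ _
    have h2 : (N + n₁ + 2) * 1 ≤ (N + n₁ + 2) * n := Nat.mul_le_mul_left _ hn
    have h3 : (N + n₁ + 3) * n = (N + n₁ + 2) * n + n := by ring
    omega
  have h1 := hB.finrank_le_finrank_add n (k * p - n) (hN _ (by omega))
  rw [Nat.add_sub_cancel' (by omega : n ≤ k * p)] at h1
  have h2 := h34 k ((Nat.le_add_left _ _).trans (Nat.le_succ _))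
  have h3 := hCA k
  calc Module.finrank K (ℬ n) ≤ 2 * (C * (k + 1) ^ d) := by omega
    _ ≤ 2 * (C * ((N + n₁ + 3) * n) ^ d) := by gcongr
    _ = _ := by rw [mul_pow]; ring

end Graded

/-! ### Comparison of the filtrations in different degrees -/

namespace RFiltration

variable {K : Type*} [Field K] {W : Type*} [AddCommGroup W] [Module K W] (𝓕 : RFiltration K W)

theorem le_lam {a : ℝ} {x : W} (h : x ∈ 𝓕.F a) : (a : EReal) ≤ 𝓕.lam x :=
  le_sSup ⟨a, h, rfl⟩

theorem mem_of_lt_lam {a : ℝ} {x : W} (h : (a : EReal) < 𝓕.lam x) : x ∈ 𝓕.F a := by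
  obtain ⟨_, ⟨b, hb, rfl⟩, hab⟩ := lt_sSup_iff.1 h
  exact 𝓕.antitone (EReal.coe_lt_coe_iff.1 hab).le hb

theorem exists_eq_top : ∃ a : ℝ, 𝓕.F a = ⊤ := 𝓕.eventually_top.exists

end RFiltration

theorem EReal.coe_fintype_sum {ι : Type*} [Fintype ι] (g : ι → ℝ) :
    ((∑ i, g i : ℝ) : EReal) = ∑ i, (g i : EReal) :=
  map_sum (⟨⟨(↑), EReal.coe_zero⟩, EReal.coe_add⟩ : ℝ →+ EReal) g Finset.univ

section Filtered

variable {K : Type*} [Field K] {B : Type*} [CommRing B] [Algebra K B] {ℬ : ℕ → Submodule K B}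

/-- The subspaces of the filtration of `B_n`, as subspaces of `B`. -/
def filtIn (𝓕 : ∀ n : ℕ, RFiltration K (ℬ n)) (n : ℕ) (a : ℝ) : Submodule K B :=
  ((𝓕 n).F a).map (ℬ n).subtype

theorem filtIn_le (𝓕 : ∀ n : ℕ, RFiltration K (ℬ n)) (n : ℕ) (a : ℝ) : filtIn 𝓕 n a ≤ ℬ n := by
  rintro _ ⟨x, -, rfl⟩
  exact x.2

theorem finrank_filtIn (𝓕 : ∀ n : ℕ, RFiltration K (ℬ n)) (n : ℕ) (a : ℝ) :
    Module.finrank K (filtIn 𝓕 n a) = Module.finrank K ((𝓕 n).F a) :=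
  Submodule.finrank_map_subtype_eq _ _

/-- The condition of being quasi-filtered in terms of the subspaces of the filtrations. -/
theorem IsQuasiFiltered.exists_prod_mem [GradedAlgebra ℬ] {𝓕 : ∀ n : ℕ, RFiltration K (ℬ n)}
    {f : ℕ → NNReal} (h : IsQuasiFiltered ℬ 𝓕 f) :
    ∃ n₀ : ℕ, ∀ (ι : Type) [Fintype ι], 2 ≤ Fintype.card ι → ∀ (e : ι → ℕ) (x : ι → B) (a : ι → ℝ),
      (∀ i, n₀ ≤ e i) → (∀ i, x i ∈ filtIn 𝓕 (e i) (a i)) → ∀ τ : ℝ,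
      τ < ∑ i, (a i - f (e i)) → ∏ i, x i ∈ filtIn 𝓕 (∑ i, e i) τ := by
  obtain ⟨n₀, h⟩ := h
  refine ⟨n₀, fun ι _ hι e x a he hx τ hτ => ?_⟩
  let σ := (Fintype.equivFin ι).symm
  choose y hy hyx using hx
  have h1 := h (Fintype.card ι) hι (fun i => e (σ i)) (fun i => he _) (fun i => y (σ i))
  have h2 : ((∑ i, (a i - f (e i)) : ℝ) : EReal) ≤
      ∑ i, ((𝓕 (e (σ i))).lam (y (σ i)) - (((f (e (σ i)) : NNReal) : ℝ) : EReal)) := by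
    rw [← Equiv.sum_comp σ, EReal.coe_fintype_sum]
    refine Finset.sum_le_sum fun i _ => ?_
    rw [EReal.coe_sub]
    exact EReal.sub_le_sub ((𝓕 _).le_lam (hy _)) le_rfl
  have h3 := (𝓕 _).mem_of_lt_lam ((EReal.coe_lt_coe_iff.2 hτ).trans_le (h2.trans h1))
  have e1 : ∑ i, e (σ i) = ∑ i, e i := Equiv.sum_comp σ e
  have e2 : ∏ i, (y (σ i) : B) = ∏ i, x i := by
    rw [Equiv.prod_comp σ (fun i => (y i : B))]
    exact Finset.prod_congr rfl fun i _ => hyx i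
  rw [← e1, ← e2]
  exact ⟨_, h3, rfl⟩

/-- Passing from a subspace `W = F_a B_q` to the products of `k`-th powers of elements of `W` with
`d * k + 1` elements of `B_m` and a fixed element of `B_r`. The latter serves to reach every large
degree, whatever its residue. The loss `(d * k + 1) * c` comes from the factors in `B_m`. -/
theorem exists_pow_mul_finrank_filtration_le [IsDomain B] [GradedAlgebra ℬ]
    (hB : IsApproximable ℬ) {𝓕 : ∀ n : ℕ, RFiltration K (ℬ n)} {f : ℕ → NNReal}
    (h : IsQuasiFiltered ℬ 𝓕 f) :
    ∃ (d C m : ℕ) (c : ℝ) (n₀ : ℕ), 0 ≤ c ∧ (∀ n, 1 ≤ n → Module.finrank K (ℬ n) ≤ C * n ^ d) ∧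
      ∀ r, n₀ ≤ r → ∃ c' : ℝ, ∀ q, n₀ ≤ q → ∀ a : ℝ, ∀ k : ℕ, 1 ≤ k →
        k ^ d * Module.finrank K ((𝓕 q).F a) ≤
          Module.finrank K ((𝓕 (q * k + m * (d * k + 1) + r)).F
            (k * (a - f q) - (d * k + 1) * c - c')) := by
  obtain ⟨N, hN⟩ := hB.exists_ne_zero
  obtain ⟨n₀, hn₀⟩ := h.exists_prod_mem
  obtain ⟨d, ⟨C, hC⟩, hpow⟩ := hB.exists_growth
  obtain ⟨m, hm, hpow⟩ := hpow n₀
  obtain ⟨tm, htm⟩ := (𝓕 m).exists_eq_top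
  refine ⟨d, C, m, max 0 (f m - tm), max n₀ N, le_max_left _ _, hC, fun r hr => ?_⟩
  obtain ⟨b, hb, hb0⟩ := hN r ((le_max_right _ _).trans hr)
  obtain ⟨tb, htb⟩ := (𝓕 r).exists_eq_top
  refine ⟨f r - tb + 1, fun q hq a k hk => ?_⟩
  set n := q * k + m * (d * k + 1) + r with hn
  set τ : ℝ := k * (a - f q) - (d * k + 1) * max 0 (f m - tm) - (f r - tb + 1) with hτ
  have hfdn := hB.finiteDimensional n
  have hfd : FiniteDimensional K (filtIn 𝓕 n τ) :=
    Submodule.finiteDimensional_of_le (filtIn_le 𝓕 n τ)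
  set Z : Submodule K B := (filtIn 𝓕 n τ).comap (LinearMap.mulRight K b) with hZ
  let g : Z →ₗ[K] filtIn 𝓕 n τ := ((LinearMap.mulRight K b).comp Z.subtype).codRestrict _
    fun z => z.2
  have hg : Function.Injective g := by
    rw [injective_iff_map_eq_zero]
    intro z hz
    have h1 : (z : B) * b = 0 := congrArg Subtype.val hz
    exact Subtype.ext ((mul_eq_zero.1 h1).resolve_right hb0)
  have hZfd : FiniteDimensional K Z := FiniteDimensional.of_injective g hg
  have hZrank : Module.finrank K Z ≤ Module.finrank K ((𝓕 n).F τ) := by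
    rw [← finrank_filtIn]
    exact LinearMap.finrank_le_finrank_of_injective hg
  have hkey : ∀ w ∈ filtIn 𝓕 q a, ∀ u ∈ (ℬ m) ^ (d * k + 1), w ^ k * u ∈ Z := by
    intro w hw
    suffices (ℬ m) ^ (d * k + 1) ≤ Z.comap (LinearMap.mulLeft K (w ^ k)) from this
    rw [Submodule.pow_eq_span_pow_set, Submodule.span_le]
    intro u hu
    obtain ⟨v, rfl⟩ := Set.mem_pow.1 hu
    rw [List.prod_ofFn]
    have h1 := hn₀ ((Fin k ⊕ Fin (d * k + 1)) ⊕ Unit) (by simp; omega)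
      (Sum.elim (Sum.elim (fun _ => q) (fun _ => m)) (fun _ => r))
      (Sum.elim (Sum.elim (fun _ => w) (fun i => (v i : B))) (fun _ => b))
      (Sum.elim (Sum.elim (fun _ => a) (fun _ => tm)) (fun _ => tb))
      (by
        rintro ((i | i) | i)
        · exact (le_max_left _ _).trans hq
        · exact hm
        · exact (le_max_left _ _).trans hr)
      (by
        rintro ((i | i) | i)
        · exact hw
        · exact ⟨⟨v i, (v i).2⟩, by change _ ∈ (𝓕 m).F tm; rw [htm]; trivial, rfl⟩
        · exact ⟨⟨b, hb⟩, by change _ ∈ (𝓕 r).F tb; rw [htb]; trivial, rfl⟩) τ (by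
        simp only [Fintype.sum_sum_type, Sum.elim_inl, Sum.elim_inr, Finset.sum_const,
          Finset.card_univ, Fintype.card_fin, nsmul_eq_mul, Fintype.card_unit, hτ]
        have h2 : ((d : ℝ) * k + 1) * (f m - tm) ≤ (d * k + 1) * max 0 (f m - tm) := by
          gcongr
          exact le_max_right _ _
        push_cast
        nlinarith)
    simp only [Fintype.sum_sum_type, Fintype.prod_sum_type, Sum.elim_inl, Sum.elim_inr,
      Finset.sum_const, Finset.prod_const, Finset.card_univ, Fintype.card_fin, smul_eq_mul,
      Fintype.card_unit, pow_one, one_mul] at h1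
    rw [mul_comm k q, mul_comm (d * k + 1) m] at h1
    exact h1
  have h5 := hpow q (filtIn 𝓕 q a) (filtIn_le 𝓕 q a) k hk Z hZfd hkey
  rw [finrank_filtIn] at h5
  exact h5.trans hZrank

/-- The asymptotic comparison of the filtration of a single `B_q` with those of all `B_n`. -/
theorem exists_eventually_le_finrank [IsDomain B] [GradedAlgebra ℬ]
    (hB : IsApproximable ℬ) {𝓕 : ∀ n : ℕ, RFiltration K (ℬ n)} {f : ℕ → NNReal}
    (h : IsQuasiFiltered ℬ 𝓕 f) :
    ∃ (d C M : ℕ) (c : ℝ) (n₀ : ℕ), 1 ≤ n₀ ∧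
      (∀ n, 1 ≤ n → Module.finrank K (ℬ n) ≤ C * n ^ d) ∧
      ∀ q, n₀ ≤ q → ∀ a s : ℝ, s * (q + M) < a - f q - c → ∀ η : ℝ, η < 1 →
        ∀ᶠ n : ℕ in atTop, η * ((n : ℝ) / (q + M)) ^ d * Module.finrank K ((𝓕 q).F a) ≤
          Module.finrank K ((𝓕 n).F (n * s)) := by
  obtain ⟨d, C, m, c, n₀, hc, hC, hcore⟩ := exists_pow_mul_finrank_filtration_le hB h
  refine ⟨d, C, m * d, d * c, n₀ + 1, by omega, hC, fun q hq a s has η hη => ?_⟩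
  choose! c' hc' using hcore
  set Q := q + m * d with hQ
  have hQpos : 0 < Q := by omega
  have hQpos' : (0 : ℝ) < Q := by exact_mod_cast hQpos
  have hQc : ((q : ℝ) + (m * d : ℕ)) = Q := by rw [hQ]; push_cast; ring
  rw [hQc] at has ⊢
  set δ := a - f q - d * c - s * Q with hδ
  have hδpos : 0 < δ := by rw [hδ]; linarith
  -- The remainder `r` in `n = Q * k + m + r` takes finitely many values, so `c''` bounds the loss.
  set c'' := ∑ r ∈ Finset.range (n₀ + Q), |c' r| with hc''
  set A : ℝ := (m + n₀ + Q : ℕ) / (Q : ℝ) with hA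
  set K₀ : ℝ := (c + c'' + (m + n₀ + Q : ℕ) * |s|) / δ with hK₀
  have ht : Tendsto (fun n : ℕ => (n : ℝ) / Q) atTop atTop :=
    tendsto_natCast_atTop_atTop.atTop_div_const hQpos'
  have hlim : Tendsto (fun n : ℕ => (1 - A / ((n : ℝ) / Q)) ^ d) atTop (𝓝 1) := by
    have h1 : Tendsto (fun n : ℕ => A / ((n : ℝ) / Q)) atTop (𝓝 0) := ht.const_div_atTop A
    have h2 := (h1.const_sub 1).pow d
    simpa using h2
  filter_upwards [hlim.eventually (lt_mem_nhds hη), ht.eventually_ge_atTop (A + max K₀ 0 + 1),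
    eventually_ge_atTop (m + n₀ + Q)] with n hn1 hn2 hn3
  set k := (n - (m + n₀)) / Q with hk
  set r := n₀ + (n - (m + n₀)) % Q with hr
  have hmod := Nat.mod_lt (n - (m + n₀)) hQpos
  have hdm := Nat.div_add_mod (n - (m + n₀)) Q
  have hn : n = Q * k + m + r := by
    rw [← hk] at hdm
    omega
  have hn' : q * k + m * (d * k + 1) + r = n := by rw [hn, hQ]; ring
  have hkA : (n : ℝ) / Q - A ≤ k := by
    rw [hA, ← sub_div, div_le_iff₀ hQpos']
    have h1 : n ≤ Q * k + (m + n₀ + Q) := by omega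
    have h2 : (n : ℝ) ≤ Q * k + (m + n₀ + Q : ℕ) := by exact_mod_cast h1
    linarith
  have hkK : K₀ ≤ k := by
    have := le_max_left K₀ 0
    linarith
  have hk1 : 1 ≤ k := by
    have h1 := le_max_right K₀ 0
    have h2 : (1 : ℝ) ≤ k := by linarith
    exact_mod_cast h2
  have hkey := hc' r (by omega) q (by omega) a k hk1
  rw [hn'] at hkey
  have hr'' : |c' r| ≤ c'' :=
    Finset.single_le_sum (f := fun r => |c' r|) (fun _ _ => abs_nonneg _)
      (Finset.mem_range.2 (by omega))
  have hle : (n : ℝ) * s ≤ k * (a - f q) - (d * k + 1) * c - c' r := by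
    have h1 : (n : ℝ) = Q * k + (m + r : ℕ) := by rw [hn]; push_cast; ring
    have h2 : ((m + r : ℕ) : ℝ) * s ≤ (m + n₀ + Q : ℕ) * |s| := by
      calc ((m + r : ℕ) : ℝ) * s ≤ (m + r : ℕ) * |s| := by
            gcongr
            exact le_abs_self s
        _ ≤ _ := mul_le_mul_of_nonneg_right
          (by exact_mod_cast (by omega : m + r ≤ m + n₀ + Q)) (abs_nonneg _)
    have h3 : c + c'' + (m + n₀ + Q : ℕ) * |s| ≤ k * δ := by
      rw [hK₀, div_le_iff₀ hδpos] at hkK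
      exact hkK
    have h4 := le_abs_self (c' r)
    rw [h1]
    have h5 : (k : ℝ) * δ = k * (a - f q) - d * k * c - Q * k * s := by rw [hδ]; ring
    nlinarith
  have hfdn := hB.finiteDimensional n
  have hmono := Submodule.finrank_mono ((𝓕 n).antitone hle)
  have h6 : (k : ℝ) ^ d * Module.finrank K ((𝓕 q).F a) ≤ Module.finrank K ((𝓕 n).F (n * s)) := by
    exact_mod_cast hkey.trans hmono
  refine le_trans ?_ h6
  gcongr
  have hnpos : (0 : ℝ) < (n : ℝ) / Q := by
    have h1 := le_max_right K₀ 0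
    have h2 : 0 ≤ A := by positivity
    linarith
  have h7 : 0 ≤ 1 - A / ((n : ℝ) / Q) := by
    rw [sub_nonneg, div_le_one hnpos]
    have h1 := le_max_right K₀ 0
    linarith
  calc η * ((n : ℝ) / Q) ^ d ≤ (1 - A / ((n : ℝ) / Q)) ^ d * ((n : ℝ) / Q) ^ d := by gcongr
    _ = ((n : ℝ) / Q - A) ^ d := by
      rw [← mul_pow, sub_mul, one_mul, div_mul_cancel₀ _ hnpos.ne']
    _ ≤ (k : ℝ) ^ d := by
      refine pow_le_pow_left₀ ?_ hkA _
      have h1 := le_max_right K₀ 0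
      linarith

end Filtered

/-! ### Vague convergence and the measures of a filtration -/

/-- Helly selection without passing to a subsequence: if the tails of the earlier measures are
dominated, up to small errors in the level and in the mass, by the tails of the later ones, and no
mass escapes to infinity, then a sequence of probability measures on `ℝ` converges. -/
theorem exists_vagueTendsto_of_isProbabilityMeasure {ν : ℕ → Measure ℝ}
    (hν : ∀ n, IsProbabilityMeasure (ν n))
    (hmono : ∀ s t : ℝ, s < t → ∀ ε > 0, ∀ᶠ q in atTop, ∀ᶠ n in atTop,
      (ν q).real (Set.Ioi t) ≤ (ν n).real (Set.Ioi s) + ε)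
    (hlow : ∀ ε > 0, ∃ s : ℝ, ∀ᶠ n in atTop, 1 - ε ≤ (ν n).real (Set.Ioi s))
    (hhigh : ∀ ε > 0, ∃ t : ℝ, ∀ᶠ n in atTop, (ν n).real (Set.Ioi t) ≤ ε) :
    ∃ ν' : Measure ℝ, IsProbabilityMeasure ν' ∧ VagueTendsto ν ν' := by
  set N : ℕ → ℝ → ℝ := fun n t => (ν n).real (Set.Ioi t) with hN
  have hN0 : ∀ n t, 0 ≤ N n t := fun n t => measureReal_nonneg
  have hN1 : ∀ n t, N n t ≤ 1 := fun n t => measureReal_le_one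
  have hb : ∀ t, IsBoundedUnder (· ≥ ·) atTop (fun n => N n t) := fun t =>
    isBoundedUnder_of ⟨0, fun n => hN0 n t⟩
  have hcb : ∀ t, IsCoboundedUnder (· ≥ ·) atTop (fun n => N n t) := fun t =>
    (isBoundedUnder_of ⟨1, fun n => hN1 n t⟩ :
      IsBoundedUnder (· ≤ ·) atTop (fun n => N n t)).isCoboundedUnder_ge
  set ℓ : ℝ → ℝ := fun t => liminf (fun n => N n t) atTop with hℓ
  have le_ℓ : ∀ {a t}, (∀ᶠ n in atTop, a ≤ N n t) → a ≤ ℓ t := fun {a t} h =>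
    le_liminf_of_le (hcb t) h
  have ℓ_lt : ∀ {a t}, a < ℓ t → ∀ᶠ n in atTop, a < N n t := fun {a t} h =>
    eventually_lt_of_lt_liminf h (hb t)
  have ℓ0 : ∀ t, 0 ≤ ℓ t := fun t => le_ℓ (Eventually.of_forall fun n => hN0 n t)
  have ℓ1 : ∀ t, ℓ t ≤ 1 := fun t => by
    by_contra! h
    obtain ⟨n, hn⟩ := (ℓ_lt h).exists
    exact absurd (hN1 n t) (not_le.2 hn)
  have hup : ∀ s t, s < t → ∀ ε > 0, ∀ᶠ q in atTop, N q t ≤ ℓ s + ε := by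
    intro s t hst ε hε
    filter_upwards [hmono s t hst ε hε] with q hq
    have : N q t - ε ≤ ℓ s := le_ℓ (by filter_upwards [hq] with n hn using by linarith)
    linarith
  have hmF : Monotone (fun t => 1 - ℓ t) := by
    intro s t hst
    have : ℓ t ≤ ℓ s := liminf_le_liminf (Eventually.of_forall fun n =>
      measureReal_mono (Set.Ioi_subset_Ioi hst)) (hb t) (hcb s)
    change 1 - ℓ s ≤ 1 - ℓ t
    linarith
  set F : ℝ → ℝ := fun t => 1 - ℓ t with hF
  have hbot : Tendsto F atBot (𝓝 0) := by
    refine tendsto_order.2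
      ⟨fun a ha => Eventually.of_forall fun t => ha.trans_le ?_, fun a ha => ?_⟩
    · simpa [hF] using ℓ1 t
    · obtain ⟨s, hs⟩ := hlow (a / 2) (by positivity)
      filter_upwards [eventually_le_atBot s] with t ht
      have := le_ℓ hs
      have h2 := hmF ht
      simp only [hF] at h2 ⊢
      linarith
  have htop : Tendsto F atTop (𝓝 1) := by
    refine tendsto_order.2 ⟨fun a ha => ?_,
      fun a ha => Eventually.of_forall fun t => lt_of_le_of_lt ?_ ha⟩
    · obtain ⟨t, ht⟩ := hhigh ((1 - a) / 2) (by linarith)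
      filter_upwards [eventually_ge_atTop t] with s hs
      have h1 : ℓ t ≤ (1 - a) / 2 := by
        by_contra! h
        obtain ⟨n, hn, hn'⟩ := ((ℓ_lt h).and ht).exists
        exact absurd hn' (not_le.2 hn)
      have h2 := hmF hs
      simp only [hF] at h2 ⊢
      linarith
    · simpa [hF] using ℓ0 t
  set G := hmF.stieltjesFunction with hG
  have hFG : ∀ t, F t ≤ G t := fun t => hmF.le_rightLim le_rfl
  have hGF : ∀ t, G t ≤ F (t + 1) := fun t => hmF.rightLim_le (lt_add_one t)
  have hGbot : Tendsto G atBot (𝓝 0) :=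
    tendsto_of_tendsto_of_tendsto_of_le_of_le hbot
      (hbot.comp (tendsto_atBot_add_const_right _ 1 tendsto_id)) hFG hGF
  have hGtop : Tendsto G atTop (𝓝 1) :=
    tendsto_of_tendsto_of_tendsto_of_le_of_le htop
      (htop.comp (tendsto_atTop_add_const_right _ 1 tendsto_id)) hFG hGF
  have hprob : IsProbabilityMeasure G.measure := G.isProbabilityMeasure hGbot hGtop
  -- At the continuity points of the limit the tails converge, and there are enough of them.
  set S : Set ℝ := {t | ContinuousAt F t} with hS
  have hdense : Dense S := by
    have := (hmF.countable_not_continuousAt).dense_compl ℝ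
    convert this using 1
    ext t
    simp [hS]
  have hGS : ∀ t ∈ S, G t = F t := fun t ht =>
    (ContinuousAt.continuousWithinAt ht).rightLim_eq
  have hlim : ∀ t ∈ S, Tendsto (fun n => N n t) atTop (𝓝 (ℓ t)) := by
    intro t ht
    refine tendsto_order.2 ⟨fun a ha => ℓ_lt ha, fun a ha => ?_⟩
    have h1 : ∀ᶠ s in 𝓝 t, 1 - (a + ℓ t) / 2 < F s :=
      (tendsto_order.1 (show Tendsto F (𝓝 t) (𝓝 (F t)) from ht)).1 _ (by simp only [hF]; linarith)
    obtain ⟨s, hs, hst⟩ := ((h1.filter_mono nhdsWithin_le_nhds).and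
      (self_mem_nhdsWithin : ∀ᶠ s in 𝓝[<] t, s ∈ Set.Iio t)).exists
    filter_upwards [hup s t hst ((a - ℓ t) / 4) (by linarith)] with q hq
    simp only [hF] at hs
    linarith
  let μ : ℕ → ProbabilityMeasure ℝ := fun n => ⟨ν n, hν n⟩
  let μ' : ProbabilityMeasure ℝ := ⟨G.measure, hprob⟩
  have hμ : Tendsto μ atTop (𝓝 μ') := by
    refine (isPiSystem_Ioc_mem S S).tendsto_probabilityMeasure_of_tendsto_of_mem ?_ ?_ ?_
    · rintro _ ⟨l, -, u, -, -, rfl⟩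
      exact measurableSet_Ioc
    · intro O hO x hx
      obtain ⟨l, u, hlu, hO'⟩ := mem_nhds_iff_exists_Ioo_subset.1 (hO.mem_nhds hx)
      obtain ⟨l', hl', h1⟩ := hdense.exists_between hlu.1
      obtain ⟨u', hu', h2⟩ := hdense.exists_between hlu.2
      exact ⟨_, ⟨l', hl', u', hu', h1.2.trans h2.1, rfl⟩, Ioc_mem_nhds h1.2 h2.1,
        fun y hy => hO' ⟨h1.1.trans hy.1, hy.2.trans_lt h2.2⟩⟩
    · rintro _ ⟨l, hl, u, hu, hlu, rfl⟩
      have h1 : Tendsto (fun n => (ν n).real (Set.Ioc l u)) atTop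
          (𝓝 (G.measure.real (Set.Ioc l u))) := by
        have h2 : G.measure.real (Set.Ioc l u) = ℓ l - ℓ u := by
          rw [measureReal_def, G.measure_Ioc, ENNReal.toReal_ofReal
            (sub_nonneg.2 (G.mono hlu.le)), hGS l hl, hGS u hu]
          simp only [hF]
          ring
        have h3 : ∀ n, (ν n).real (Set.Ioc l u) = N n l - N n u := fun n => by
          rw [hN, ← Set.Ioi_sdiff_Ioi, measureReal_sdiff (Set.Ioi_subset_Ioi hlu.le)
            measurableSet_Ioi]
        simp only [h2, h3]
        exact (hlim l hl).sub (hlim u hu)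
      rw [← NNReal.tendsto_coe]
      exact h1
  refine ⟨G.measure, hprob, fun h hc hs => ?_⟩
  obtain ⟨C, hC⟩ := hs.exists_bound_of_continuous hc
  exact ProbabilityMeasure.tendsto_iff_forall_integral_tendsto.1 hμ
    (BoundedContinuousFunction.ofNormedAddCommGroup h hc C hC)

/-- The version of `exists_vagueTendsto_of_isProbabilityMeasure` in which finitely many of the
measures are arbitrary. -/
theorem exists_vagueTendsto {ν : ℕ → Measure ℝ}
    (hν : ∀ᶠ n in atTop, IsProbabilityMeasure (ν n))
    (hmono : ∀ s t : ℝ, s < t → ∀ ε > 0, ∀ᶠ q in atTop, ∀ᶠ n in atTop,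
      (ν q).real (Set.Ioi t) ≤ (ν n).real (Set.Ioi s) + ε)
    (hlow : ∀ ε > 0, ∃ s : ℝ, ∀ᶠ n in atTop, 1 - ε ≤ (ν n).real (Set.Ioi s))
    (hhigh : ∀ ε > 0, ∃ t : ℝ, ∀ᶠ n in atTop, (ν n).real (Set.Ioi t) ≤ ε) :
    ∃ ν' : Measure ℝ, IsProbabilityMeasure ν' ∧ VagueTendsto ν ν' := by
  classical
  let ν₁ : ℕ → Measure ℝ := fun n => if IsProbabilityMeasure (ν n) then ν n else Measure.dirac 0
  have h1 : ∀ᶠ n in atTop, ν₁ n = ν n := hν.mono fun n hn => if_pos hn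
  obtain ⟨ν', h2, h3⟩ := exists_vagueTendsto_of_isProbabilityMeasure (ν := ν₁)
    (fun n => by
      by_cases h : IsProbabilityMeasure (ν n)
      · simpa only [ν₁, if_pos h] using h
      · simpa only [ν₁, if_neg h] using Measure.dirac.isProbabilityMeasure)
    (fun s t hst ε hε => by
      filter_upwards [hmono s t hst ε hε, h1] with q hq hq1
      filter_upwards [hq, h1] with n hn hn1
      rwa [hq1, hn1])
    (fun ε hε => (hlow ε hε).imp fun s hs => by
      filter_upwards [hs, h1] with n hn hn1
      rwa [hn1])
    (fun ε hε => (hhigh ε hε).imp fun s hs => by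
      filter_upwards [hs, h1] with n hn hn1
      rwa [hn1])
  refine ⟨ν', h2, fun h hc hs => (h3 h hc hs).congr' ?_⟩
  filter_upwards [h1] with n hn
  rw [hn]

namespace RFiltration

variable {K : Type*} [Field K] {W : Type*} [AddCommGroup W] [Module K W] (𝓕 : RFiltration K W)

theorem tendsto_stieltjes_atBot (hW : FiniteDimensional K W) (hne : Nontrivial W) :
    Tendsto (𝓕.negRank_mono hW).stieltjesFunction atBot (𝓝 (-1)) := by
  obtain ⟨a, ha⟩ := eventually_atBot.1 𝓕.eventually_top
  have hpos : (Module.finrank K W : ℝ) ≠ 0 := by exact_mod_cast Module.finrank_pos.ne'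
  have h : ∀ t ≤ a, 𝓕.negRank t = -1 := fun t ht => by
    rw [negRank, ha t ht, finrank_top, div_self hpos]
  refine tendsto_const_nhds.congr' ?_
  filter_upwards [eventually_le_atBot (a - 1)] with t ht
  refine le_antisymm ?_ ?_
  · rw [← h t (by linarith)]
    exact (𝓕.negRank_mono hW).le_rightLim le_rfl
  · rw [← h (t + 1) (by linarith)]
    exact (𝓕.negRank_mono hW).rightLim_le (lt_add_one t)

theorem tendsto_stieltjes_atTop (hW : FiniteDimensional K W) :
    Tendsto (𝓕.negRank_mono hW).stieltjesFunction atTop (𝓝 0) := by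
  obtain ⟨a, ha⟩ := eventually_atTop.1 𝓕.eventually_bot
  have h : ∀ t ≥ a, 𝓕.negRank t = 0 := fun t ht => by
    rw [negRank, ha t ht, finrank_bot]
    simp
  refine tendsto_const_nhds.congr' ?_
  filter_upwards [eventually_ge_atTop a] with t ht
  refine le_antisymm ?_ ?_
  · rw [← h t ht]
    exact (𝓕.negRank_mono hW).le_rightLim le_rfl
  · rw [← h (t + 1) (by linarith)]
    exact (𝓕.negRank_mono hW).rightLim_le (lt_add_one t)

theorem isProbabilityMeasure_nu (hW : FiniteDimensional K W) (hne : Nontrivial W) :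
    IsProbabilityMeasure (𝓕.nu hW) :=
  ⟨by simp [nu, StieltjesFunction.measure_univ _ (𝓕.tendsto_stieltjes_atBot hW hne)
    (𝓕.tendsto_stieltjes_atTop hW)]⟩

theorem nu_real_Ioi (hW : FiniteDimensional K W) (t : ℝ) :
    (𝓕.nu hW).real (Set.Ioi t) = -(𝓕.negRank_mono hW).stieltjesFunction t := by
  have h0 := 𝓕.tendsto_stieltjes_atTop hW
  rw [measureReal_def, nu, StieltjesFunction.measure_Ioi _ h0, zero_sub, ENNReal.toReal_ofReal]
  exact neg_nonneg.2 ((𝓕.negRank_mono hW).stieltjesFunction.mono.ge_of_tendsto h0 t)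

/-- The tails of `nu` are the right limits of the proportions `rk F_t / rk W`, hence lie between the
proportion at `t` and those at larger levels (`le_nu_real_Ioi`). -/
theorem nu_real_Ioi_le (hW : FiniteDimensional K W) (t : ℝ) :
    (𝓕.nu hW).real (Set.Ioi t) ≤ (Module.finrank K (𝓕.F t) : ℝ) / Module.finrank K W := by
  have := (𝓕.negRank_mono hW).le_rightLim (le_refl t)
  rw [𝓕.nu_real_Ioi hW, neg_le]
  exact this

theorem le_nu_real_Ioi (hW : FiniteDimensional K W) {s t : ℝ} (hst : s < t) :
    (Module.finrank K (𝓕.F t) : ℝ) / Module.finrank K W ≤ (𝓕.nu hW).real (Set.Ioi s) := by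
  have := (𝓕.negRank_mono hW).rightLim_le hst
  rw [𝓕.nu_real_Ioi hW, le_neg]
  exact this

end RFiltration

theorem dilate_real_Ioi {n : ℕ} (hn : 1 ≤ n) (ν : Measure ℝ) (t : ℝ) :
    (dilate (1 / (n : ℝ)) ν).real (Set.Ioi t) = ν.real (Set.Ioi (n * t)) := by
  have hn0 : (0 : ℝ) < n := by exact_mod_cast hn
  rw [dilate, map_measureReal_apply (by fun_prop) measurableSet_Ioi]
  congr 1
  ext x
  simp only [Set.mem_preimage, Set.mem_Ioi, one_div, inv_mul_eq_div, lt_div_iff₀ hn0, mul_comm t]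

theorem isProbabilityMeasure_dilate (a : ℝ) {ν : Measure ℝ} (h : IsProbabilityMeasure ν) :
    IsProbabilityMeasure (dilate a ν) :=
  Measure.isProbabilityMeasure_map (by fun_prop)

/-! ### Convergence -/

/-- A bounded sequence that is almost increasing from each of its terms on converges, and the limit
is positive if some term is. -/
theorem exists_tendsto_of_eventually_mul_le {u κ : ℕ → ℝ} {C : ℝ} (hC : ∀ᶠ n in atTop, u n ≤ C)
    (hu : ∀ n, 0 ≤ u n) (hκ : Tendsto κ atTop (𝓝 1))
    (h : ∀ᶠ q in atTop, ∀ η < 1, ∀ᶠ n in atTop, η * (κ q * u q) ≤ u n)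
    (hpos : ∀ᶠ q in atTop, 0 < u q) : ∃ ρ, 0 < ρ ∧ Tendsto u atTop (𝓝 ρ) := by
  have hb : IsBoundedUnder (· ≥ ·) atTop u := isBoundedUnder_of ⟨0, hu⟩
  have hb' : IsBoundedUnder (· ≤ ·) atTop u := ⟨C, hC⟩
  have h1 : ∀ᶠ q in atTop, κ q * u q ≤ liminf u atTop := by
    filter_upwards [h] with q hq
    have h2 : ∀ η < 1, η * (κ q * u q) ≤ liminf u atTop := fun η hη =>
      le_liminf_of_le hb'.isCoboundedUnder_ge (hq η hη)
    have h3 : Tendsto (fun η : ℝ => η * (κ q * u q)) (𝓝[<] 1) (𝓝 (1 * (κ q * u q))) :=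
      (tendsto_id.mono_left nhdsWithin_le_nhds).mul_const _
    rw [one_mul] at h3
    exact le_of_tendsto h3 (by filter_upwards [self_mem_nhdsWithin] with η hη using h2 η hη)
  have h4 : ∀ᶠ q in atTop, 0 < κ q := hκ.eventually (lt_mem_nhds one_pos)
  refine ⟨liminf u atTop, ?_, ?_⟩
  · obtain ⟨q, hq1, hq2, hq3⟩ := (h1.and (h4.and hpos)).exists
    exact (mul_pos hq2 hq3).trans_le hq1
  · have h5 : Tendsto (fun q => liminf u atTop / κ q) atTop (𝓝 (liminf u atTop)) := by
      have h6 := (tendsto_const_nhds (x := liminf u atTop)).div hκ one_ne_zero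
      rw [div_one] at h6
      exact h6
    refine tendsto_order.2 ⟨fun a ha => eventually_lt_of_lt_liminf ha hb, fun a ha => ?_⟩
    filter_upwards [h5.eventually (gt_mem_nhds ha), h1, h4] with q hq1 hq2 hq3
    exact lt_of_le_of_lt ((le_div_iff₀ hq3).2 (by linarith)) hq1

theorem tendsto_div_add_pow (M d : ℕ) :
    Tendsto (fun q : ℕ => ((q : ℝ) / (q + M)) ^ d) atTop (𝓝 1) := by
  have h := (tendsto_natCast_div_add_atTop (𝕜 := ℝ) (M : ℝ)).pow d
  simpa using h

/-- The defects `M`, `c` and `f q` are negligible compared with `q`. -/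
theorem eventually_mul_add_lt {f : ℕ → NNReal}
    (hf : Tendsto (fun n : ℕ => (f n : ℝ) / (n : ℝ)) atTop (𝓝 0)) (M c : ℝ) {s t : ℝ}
    (hst : s < t) : ∀ᶠ q : ℕ in atTop, s * (q + M) < q * t - f q - c := by
  have h1 : Tendsto (fun q : ℕ => s + (s * M + c) / (q : ℝ) + (f q : ℝ) / q) atTop
      (𝓝 (s + 0 + 0)) :=
    (tendsto_const_nhds.add (tendsto_const_div_atTop_nhds_zero_nat _)).add hf
  rw [add_zero, add_zero] at h1
  filter_upwards [h1.eventually (gt_mem_nhds hst), eventually_ge_atTop 1] with q hq hq1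
  have hq0 : (0 : ℝ) < q := by exact_mod_cast hq1
  rw [add_assoc, ← add_div, ← lt_sub_iff_add_lt', div_lt_iff₀ hq0] at hq
  linarith

section Limits

variable {K : Type*} [Field K] {B : Type*} [CommRing B] [Algebra K B] {ℬ : ℕ → Submodule K B}
  (𝓕 : ∀ n : ℕ, RFiltration K (ℬ n))

theorem le_lamMax_div {n : ℕ} (hn : 1 ≤ n) {s : ℝ} (h : (𝓕 n).F (n * s) ≠ ⊥) :
    (s : EReal) ≤ (𝓕 n).lamMax / (n : EReal) := by
  obtain ⟨x, hx, hx0⟩ := Submodule.exists_mem_ne_zero_of_ne_bot h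
  have hn0 : (0 : ℝ) < n := by exact_mod_cast hn
  rw [EReal.le_div_iff_mul_le (by exact_mod_cast hn0) (EReal.natCast_ne_top n)]
  refine le_trans ?_ (((𝓕 n).le_lam hx).trans (le_iSup (fun x : {x : ℬ n // x ≠ 0} =>
    (𝓕 n).lam x) ⟨x, hx0⟩))
  rw [mul_comm (n : ℝ) s]
  rfl

theorem ne_bot_of_lt_lamMax_div {n : ℕ} (hn : 1 ≤ n) {s : ℝ}
    (h : (s : EReal) < (𝓕 n).lamMax / (n : EReal)) : (𝓕 n).F (n * s) ≠ ⊥ := by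
  have hn0 : (0 : ℝ) < n := by exact_mod_cast hn
  rw [EReal.lt_div_iff (by exact_mod_cast hn0) (EReal.natCast_ne_top n)] at h
  obtain ⟨x, hx⟩ := lt_iSup_iff.1 h
  have h1 : ((n * s : ℝ) : EReal) < (𝓕 n).lam x := by
    rw [mul_comm (n : ℝ) s]
    exact hx
  exact fun hb => x.2 ((Submodule.mem_bot K).1 (hb ▸ (𝓕 n).mem_of_lt_lam h1))

/-- The proportion of `B_n` occupied by the subspace of level `t`. -/
def rankRatio (n : ℕ) (t : ℝ) : ℝ :=
  (Module.finrank K ((𝓕 n).F t) : ℝ) / Module.finrank K (ℬ n)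

variable [IsDomain B] [GradedAlgebra ℬ] {𝓕} {f : ℕ → NNReal}

/-- The proportions in degree `q` bound those in all large degrees from below. With `a` such that
`F_a B_q = B_q`, the comparison of ranks shows that `rk B_n / n ^ d` converges to a positive number,
so it can be normalised to a comparison of proportions. -/
theorem exists_eventually_rankRatio_le (hB : IsApproximable ℬ) (hqf : IsQuasiFiltered ℬ 𝓕 f) :
    ∃ M c : ℝ, ∀ ε > 0, ∀ᶠ q : ℕ in atTop, ∀ a s : ℝ,
    s * (q + M) < a - f q - c →
      ∀ᶠ n : ℕ in atTop, rankRatio 𝓕 q a ≤ rankRatio 𝓕 n (n * s) + ε := by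
  obtain ⟨d, C, M, c, n₀, hn₀, hC, h⟩ := exists_eventually_le_finrank hB hqf
  have := hB.finiteDimensional
  set u : ℕ → ℝ := fun n => (Module.finrank K (ℬ n) : ℝ) / n ^ d with hu
  have hκ := tendsto_div_add_pow M d
  -- The lower bound, normalised by `q ^ d` and `n ^ d`.
  have key : ∀ q : ℕ, 1 ≤ q → ∀ n : ℕ, 1 ≤ n → ∀ η x y : ℝ,
      η * ((n : ℝ) / (q + M)) ^ d * x ≤ y →
        η * (((q : ℝ) / (q + M)) ^ d * (x / q ^ d)) ≤ y / n ^ d := by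
    intro q hq n hn η x y hxy
    have hq0 : (0 : ℝ) < q := by exact_mod_cast hq
    have hn0 : (0 : ℝ) < n := by exact_mod_cast hn
    have hqM : (0 : ℝ) < q + M := by positivity
    rw [le_div_iff₀ (by positivity)]
    refine le_of_eq_of_le ?_ hxy
    rw [div_pow, div_pow]
    field_simp
  have hupos : ∀ᶠ q in atTop, 0 < u q := by
    filter_upwards [hB.eventually_ne_bot, eventually_ge_atTop 1] with q hq hq1
    have : Nontrivial (ℬ q) := Submodule.nontrivial_iff_ne_bot.2 hq
    have h1 : (0 : ℝ) < Module.finrank K (ℬ q) := by exact_mod_cast Module.finrank_pos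
    have hq0 : (0 : ℝ) < q := by exact_mod_cast hq1
    exact div_pos h1 (by positivity)
  obtain ⟨ρ, hρ, hlim⟩ := exists_tendsto_of_eventually_mul_le (u := u) (C := C)
    (by
      filter_upwards [eventually_ge_atTop 1] with n hn
      have hn0 : (0 : ℝ) < n := by exact_mod_cast hn
      rw [hu, div_le_iff₀ (by positivity)]
      exact_mod_cast hC n hn)
    (fun n => by positivity) hκ
    (by
      filter_upwards [eventually_ge_atTop n₀] with q hq η hη
      obtain ⟨a, ha⟩ := (𝓕 q).exists_eq_top
      have hq0 : (0 : ℝ) < q + M := by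
        have : (0 : ℝ) < q := by exact_mod_cast hn₀.trans hq
        positivity
      filter_upwards [h q hq a ((a - f q - c - 1) / (q + M))
        (by rw [div_mul_cancel₀ _ hq0.ne']; linarith) η hη, eventually_ge_atTop 1] with n hn hn1
      refine key q (hn₀.trans hq) n hn1 η _ _ (hn.trans' (le_of_eq ?_) |>.trans ?_)
      · rw [ha, finrank_top]
      · exact_mod_cast Submodule.finrank_le _)
    hupos
  refine ⟨M, c, fun ε hε => ?_⟩
  obtain ⟨δ, hδ0, hδ1, hδ⟩ : ∃ δ : ℝ, 0 < δ ∧ δ < 1 ∧ 3 * δ ≤ ε :=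
    ⟨min (ε / 3) (1 / 2), by positivity, (min_le_right _ _).trans_lt (by norm_num),
      by linarith [min_le_left (ε / 3) (1 / 2)]⟩
  have h1 : Tendsto (fun q : ℕ => ((q : ℝ) / (q + M)) ^ d * u q) atTop (𝓝 (1 * ρ)) := hκ.mul hlim
  have h2 : Tendsto (fun n : ℕ => (1 - δ) * u n) atTop (𝓝 ((1 - δ) * ρ)) := hlim.const_mul _
  filter_upwards [h1.eventually (lt_mem_nhds (show (1 - δ) * ρ < 1 * ρ by gcongr; linarith)),
    eventually_ge_atTop n₀, hupos] with q hq1 hq2 hq3 a s has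
  filter_upwards [h2.eventually (gt_mem_nhds (show (1 - δ) * ρ < ρ by nlinarith)),
    h q hq2 a s has (1 - δ) (by linarith), eventually_ge_atTop 1, hupos] with n hn1 hn2 hn3 hn4
  have h3 := key q (hn₀.trans hq2) n hn3 _ _ _ hn2
  have hR : ∀ m : ℕ, 1 ≤ m → 0 < u m → ∀ t,
      (Module.finrank K ((𝓕 m).F t) : ℝ) / m ^ d = rankRatio 𝓕 m t * u m := by
    intro m hm hm' t
    have hm0 : (0 : ℝ) < m := by exact_mod_cast hm
    have h5 : (Module.finrank K (ℬ m) : ℝ) ≠ 0 := fun h0 => by simp [hu, h0] at hm'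
    rw [rankRatio, hu]
    field_simp
  rw [hR q (hn₀.trans hq2) hq3, hR n hn3 hn4] at h3
  set x := rankRatio 𝓕 q a with hx
  set y := rankRatio 𝓕 n (n * s) with hy
  have hx0 : 0 ≤ x := by rw [hx, rankRatio]; positivity
  have hx1 : x ≤ 1 := div_le_one_of_le₀ (by exact_mod_cast Submodule.finrank_le _) (by positivity)
  -- `y u_n ≥ (1 - δ) κ_q u_q x ≥ (1 - δ)² ρ x ≥ (1 - δ)³ u_n x`
  have h6 : (1 - δ) ^ 3 * x ≤ y := by
    refine le_of_mul_le_mul_right (le_trans ?_ h3) hn4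
    calc (1 - δ) ^ 3 * x * u n = (1 - δ) ^ 2 * x * ((1 - δ) * u n) := by ring
      _ ≤ (1 - δ) ^ 2 * x * ρ := by gcongr
      _ = (1 - δ) * x * ((1 - δ) * ρ) := by ring
      _ ≤ (1 - δ) * x * (((q : ℝ) / (q + M)) ^ d * u q) :=
        mul_le_mul_of_nonneg_left hq1.le (mul_nonneg (by linarith) hx0)
      _ = _ := by ring
  have h7 : 1 - 3 * δ ≤ (1 - δ) ^ 3 := by nlinarith [sq_nonneg δ]
  nlinarith [mul_le_mul_of_nonneg_right h7 hx0]

theorem exists_tendsto_lamMax_div (hB : IsApproximable ℬ) (hqf : IsQuasiFiltered ℬ 𝓕 f)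
    (hsup : (⨆ n : ℕ, ⨆ _ : 1 ≤ n, (𝓕 n).lamMax / (n : EReal)) < ⊤)
    (hf : Tendsto (fun n : ℕ => (f n : ℝ) / (n : ℝ)) atTop (𝓝 0)) :
    ∃ L : ℝ, Tendsto (fun n : ℕ => (𝓕 n).lamMax / (n : EReal)) atTop (𝓝 (L : EReal)) := by
  obtain ⟨d, -, M, c, n₀, hn₀, -, h⟩ := exists_eventually_le_finrank hB hqf
  have := hB.finiteDimensional
  -- A nonzero element of level `a` in one degree `q` forces elements of level `n * s` in all large
  -- degrees `n`.
  set Λ : ℕ → EReal := fun n => (𝓕 n).lamMax / (n : EReal) with hΛ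
  have key : ∀ q, n₀ ≤ q → ∀ a s : ℝ, s * (q + M) < a - f q - c → (𝓕 q).F a ≠ ⊥ →
      (s : EReal) ≤ liminf Λ atTop := by
    intro q hq a s has ha
    refine le_liminf_of_le (by isBoundedDefault) ?_
    filter_upwards [h q hq a s has (1 / 2) (by norm_num), eventually_ge_atTop 1] with n hn hn1
    refine le_lamMax_div 𝓕 hn1 fun hb => ?_
    rw [hb, finrank_bot, Nat.cast_zero] at hn
    have h1 : (0 : ℝ) < Module.finrank K ((𝓕 q).F a) :=
      Nat.cast_pos.2 (Nat.pos_of_ne_zero fun h0 => ha (Submodule.finrank_eq_zero.1 h0))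
    have hn0 : (0 : ℝ) < n := by exact_mod_cast hn1
    have hq0 : (0 : ℝ) < q := by exact_mod_cast hn₀.trans hq
    exact absurd hn (not_le.2 (by positivity))
  have hle : limsup Λ atTop ≤ liminf Λ atTop := by
    refine le_of_forall_lt fun b hb => ?_
    obtain ⟨t, hbt, ht⟩ := EReal.lt_iff_exists_real_btwn.1 hb
    obtain ⟨s, hbs, hst⟩ := EReal.lt_iff_exists_real_btwn.1 hbt
    have h1 : ∃ᶠ q in atTop, (t : EReal) < Λ q :=
      frequently_lt_of_lt_limsup (by isBoundedDefault) ht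
    obtain ⟨q, hq1, hq2, hq3⟩ := (h1.and_eventually
      ((eventually_mul_add_lt hf M c (EReal.coe_lt_coe_iff.1 hst)).and
        (eventually_ge_atTop n₀))).exists
    exact hbs.trans_le (key q hq3 _ s hq2 (ne_bot_of_lt_lamMax_div 𝓕 (hn₀.trans hq3) hq1))
  have htop : limsup Λ atTop ≠ ⊤ := by
    refine ne_top_of_le_ne_top hsup.ne (limsup_le_of_le (by isBoundedDefault) ?_)
    filter_upwards [eventually_ge_atTop 1] with n hn
    exact le_iSup₂ (f := fun (n : ℕ) (_ : 1 ≤ n) => (𝓕 n).lamMax / (n : EReal)) n hn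
  have hbot : limsup Λ atTop ≠ ⊥ := by
    obtain ⟨q, hq1, hq2⟩ := (hB.eventually_ne_bot.and (eventually_ge_atTop n₀)).exists
    obtain ⟨a, ha⟩ := (𝓕 q).exists_eq_top
    have hq0 : (0 : ℝ) < q + M := by
      have : (0 : ℝ) < q := by exact_mod_cast hn₀.trans hq2
      positivity
    have : Nontrivial (ℬ q) := Submodule.nontrivial_iff_ne_bot.2 hq1
    have h1 := key q hq2 a ((a - f q - c - 1) / (q + M))
      (by rw [div_mul_cancel₀ _ hq0.ne']; linarith) (ha ▸ top_ne_bot)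
    exact ne_bot_of_le_ne_bot (EReal.coe_ne_bot _) (h1.trans (liminf_le_limsup))
  refine ⟨(limsup Λ atTop).toReal, ?_⟩
  rw [EReal.coe_toReal htop hbot]
  exact tendsto_of_le_liminf_of_limsup_le hle le_rfl

theorem exists_vagueTendsto_dilate_nu (hB : IsApproximable ℬ) (hqf : IsQuasiFiltered ℬ 𝓕 f)
    (hsup : (⨆ n : ℕ, ⨆ _ : 1 ≤ n, (𝓕 n).lamMax / (n : EReal)) < ⊤)
    (hf : Tendsto (fun n : ℕ => (f n : ℝ) / (n : ℝ)) atTop (𝓝 0)) :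
    ∃ ν : Measure ℝ, IsProbabilityMeasure ν ∧
      VagueTendsto (fun n : ℕ => dilate (1 / (n : ℝ)) ((𝓕 n).nu (hB.finiteDimensional n))) ν := by
  obtain ⟨M, c, h⟩ := exists_eventually_rankRatio_le hB hqf
  set ν : ℕ → Measure ℝ := fun n => dilate (1 / (n : ℝ)) ((𝓕 n).nu (hB.finiteDimensional n))
  have le_ratio : ∀ n : ℕ, 1 ≤ n → ∀ t, (ν n).real (Set.Ioi t) ≤ rankRatio 𝓕 n (n * t) :=
    fun n hn t => by
      rw [dilate_real_Ioi hn]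
      exact (𝓕 n).nu_real_Ioi_le _ _
  have ratio_le : ∀ n : ℕ, 1 ≤ n → ∀ s t, s < t →
      rankRatio 𝓕 n (n * t) ≤ (ν n).real (Set.Ioi s) := fun n hn s t hst => by
    have hn0 : (0 : ℝ) < n := by exact_mod_cast hn
    rw [dilate_real_Ioi hn]
    exact (𝓕 n).le_nu_real_Ioi _ (by gcongr)
  refine exists_vagueTendsto ?_ ?_ ?_ ?_
  · filter_upwards [hB.eventually_ne_bot] with n hn
    exact isProbabilityMeasure_dilate _
      ((𝓕 n).isProbabilityMeasure_nu _ (Submodule.nontrivial_iff_ne_bot.2 hn))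
  · intro s t hst ε hε
    filter_upwards [h ε hε, eventually_ge_atTop 1,
      eventually_mul_add_lt hf M c (show (s + t) / 2 < t by linarith)] with q hq hq1 hq2
    filter_upwards [hq _ _ hq2, eventually_ge_atTop 1] with n hn hn1
    linarith [le_ratio q hq1 t, ratio_le n hn1 s ((s + t) / 2) (by linarith)]
  · intro ε hε
    -- Compare with one degree `q` and a level at which the filtration of `B_q` is everything.
    obtain ⟨q, hq1, hq2, hq3⟩ := ((h ε hε).and (hB.eventually_ne_bot.and
      (tendsto_natCast_atTop_atTop.eventually_gt_atTop (-M)))).exists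
    obtain ⟨a, ha⟩ := (𝓕 q).exists_eq_top
    have hq0 : (0 : ℝ) < q + M := by linarith
    have := hB.finiteDimensional q
    have : Nontrivial (ℬ q) := Submodule.nontrivial_iff_ne_bot.2 hq2
    have hr : rankRatio 𝓕 q a = 1 := by
      rw [rankRatio, ha, finrank_top, div_self (by exact_mod_cast Module.finrank_pos.ne')]
    refine ⟨(a - f q - c - 1) / (q + M) - 1, ?_⟩
    filter_upwards [hq1 a ((a - f q - c - 1) / (q + M))
      (by rw [div_mul_cancel₀ _ hq0.ne']; linarith), eventually_ge_atTop 1] with n hn hn1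
    linarith [ratio_le n hn1 _ _ (sub_one_lt ((a - f q - c - 1) / (q + M)))]
  · intro ε hε
    obtain ⟨T, hT, -⟩ := EReal.lt_iff_exists_real_btwn.1 hsup
    refine ⟨T, ?_⟩
    filter_upwards [eventually_ge_atTop 1] with n hn
    refine (le_ratio n hn T).trans ?_
    have hb : (𝓕 n).F (n * T) = ⊥ := by
      by_contra hb
      exact absurd ((le_lamMax_div 𝓕 hn hb).trans (le_iSup₂
        (f := fun (n : ℕ) (_ : 1 ≤ n) => (𝓕 n).lamMax / (n : EReal)) n hn)) (not_le.2 hT)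
    rw [rankRatio, hb, finrank_bot]
    simpa using hε.le

end Limits

theorem mainTheorem4 {K : Type*} [Field K] {B : Type*} [CommRing B] [IsDomain B] [Algebra K B]
    (ℬ : ℕ → Submodule K B) [GradedAlgebra ℬ] (hB : IsApproximable ℬ)
    (𝓕 : ∀ n : ℕ, RFiltration K (ℬ n)) (f : ℕ → NNReal)
    (hqf : IsQuasiFiltered ℬ 𝓕 f)
    (hsup : (⨆ n : ℕ, ⨆ _ : 1 ≤ n, (𝓕 n).lamMax / (n : EReal)) < ⊤)
    (hf : Tendsto (fun n : ℕ => (f n : ℝ) / (n : ℝ)) atTop (𝓝 0)) :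
    (∃ L : ℝ, Tendsto (fun n : ℕ => (𝓕 n).lamMax / (n : EReal)) atTop (𝓝 (L : EReal))) ∧
    ∃ ν : Measure ℝ, IsProbabilityMeasure ν ∧
      VagueTendsto (fun n : ℕ => dilate (1 / (n : ℝ)) ((𝓕 n).nu (hB.finiteDimensional n))) ν :=
  ⟨exists_tendsto_lamMax_div hB hqf hsup hf, exists_vagueTendsto_dilate_nu hB hqf hsup hf⟩

end
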